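/- Let $(\Omega,\mathcal F,(\mathcal F_t)_{t\ge 0},\mathbb Q)$ be a filtered probability space and $B$ a standard Brownian motion with respect to $(\mathcal F_t)_{t\ge0}$. Let $r\in\mathbb R$ and $\sigma>0$, and let $S$ be a continuous adapted solution of $$\mathrm dS_t=r S_t\,\mathrm dt+\sigma S_t\,\mathrm dB_t,\qquad S_0=1 .$$ For $t>0$ put $A_t=\frac1t\int_0^t S_u\,\mathrm du$, and for $n\in\mathbb N=\{0,1,2,\dots\}$ write $H_n(x)=(1,x,\ldots,x^n)^\top$. Then for every $T>0$ and every $n\in\mathbb N$ the random vector $H_n(A_T)$ is integrable and $$\mathbb E\left[H_n(A_T)\right]=\mathrm e^{G_nT}H_n(0),$$ where $G_n\in\mathbb R^{(n+1)\times(n+1)}$, with rows and columns indexed by $0,\ldots,n$, is the lower bidiagonal matrix with entries $$(G_n)_{k,k}=kr+\tfrac12k(k-1)\sigma^2\quad(0\le k\le n),\qquad (G_n)_{k,k-1}=\frac kT\quad(1\le k\le n),$$ and all other entries equal to $0$. -/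

import Mathlib

open MeasureTheory ProbabilityTheory Filter Topology
open scoped NNReal Matrix

noncomputable section

/-- `B` is a standard Brownian motion relative to the filtration `𝓕`: a Brownian motion (started at
`0`, with the Gaussian finite-dimensional laws and a.s. continuous paths) that is adapted to `𝓕` and
whose increments after time `s` are independent of `𝓕 s`. -/
structure IsStdBrownianMotion {Ω : Type*} {mΩ : MeasurableSpace Ω}
    (𝓕 : Filtration ℝ≥0 mΩ) (B : ℝ≥0 → Ω → ℝ) (Q : Measure Ω) : Prop where
  isBrownian : IsBrownianReal B Q
  adapted : ∀ t, Measurable[𝓕 t] (B t)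
  indep_increments : ∀ s t, s ≤ t →
    Indep (MeasurableSpace.comap (fun ω ↦ B t ω - B s ω) (borel ℝ)) (𝓕 s) Q

/-- `(N n, π n)` is a sequence of finite partitions
`0 = π n 0 ≤ π n 1 ≤ … ≤ π n (N n) = t` of `[0, t]` whose mesh tends to `0`. -/
structure IsVanishingPartition (t : ℝ≥0) (N : ℕ → ℕ) (π : ℕ → ℕ → ℝ≥0) : Prop where
  mono : ∀ n, Monotone (π n)
  left : ∀ n, π n 0 = 0
  right : ∀ n, π n (N n) = t
  mesh : ∀ ε : ℝ, 0 < ε → ∀ᶠ n in atTop, ∀ k < N n, (π n (k + 1) : ℝ) - (π n k : ℝ) ≤ ε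

/-- `I` is the Itô integral process `I t = ∫₀ᵗ H u dB u` of the adapted process `H` with a.s.
continuous paths: for every `t` and every sequence of partitions of `[0, t]` with mesh tending to
`0`, the left-endpoint sums `∑ₖ H (tₖ) (B (tₖ₊₁) - B (tₖ))` converge to `I t` in probability. -/
structure IsItoIntegral {Ω : Type*} {mΩ : MeasurableSpace Ω}
    (𝓕 : Filtration ℝ≥0 mΩ) (B H I : ℝ≥0 → Ω → ℝ) (Q : Measure Ω) : Prop where
  adapted : ∀ t, Measurable[𝓕 t] (H t)
  continuous : ∀ᵐ ω ∂Q, Continuous (fun t ↦ H t ω)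
  tendsto : ∀ (t : ℝ≥0) (N : ℕ → ℕ) (π : ℕ → ℕ → ℝ≥0), IsVanishingPartition t N π →
    TendstoInMeasure Q
      (fun n ω ↦ ∑ k ∈ Finset.range (N n),
        H (π n k) ω * (B (π n (k + 1)) ω - B (π n k) ω))
      atTop (I t)

/-- `S` is a solution, adapted and with a.s. continuous paths, of
`dS t = r * S t dt + σ * S t dB t`, `S 0 = 1`, in integrated form. -/
def IsBlackScholesPrice {Ω : Type*} {mΩ : MeasurableSpace Ω}
    (𝓕 : Filtration ℝ≥0 mΩ) (B : ℝ≥0 → Ω → ℝ) (r σ : ℝ) (S : ℝ≥0 → Ω → ℝ)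
    (Q : Measure Ω) : Prop :=
  ∃ I : ℝ≥0 → Ω → ℝ, IsItoIntegral 𝓕 B S I Q ∧
    ∀ t : ℝ≥0, ∀ᵐ ω ∂Q,
      S t ω = 1 + r * (∫ u in (0 : ℝ)..(t : ℝ), S u.toNNReal ω) + σ * I t ω

/-- The average price `A t = (1 / t) * ∫₀ᵗ S u du`. -/
def averagePrice {Ω : Type*} (S : ℝ≥0 → Ω → ℝ) (t : ℝ≥0) (ω : Ω) : ℝ :=
  (1 / (t : ℝ)) * ∫ u in (0 : ℝ)..(t : ℝ), S u.toNNReal ω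

/-- The vector of monomials `H_n(x) = (1, x, …, x ^ n)`. -/
def monomialVec (n : ℕ) (x : ℝ) : Fin (n + 1) → ℝ := fun k ↦ x ^ (k : ℕ)

/-- The lower bidiagonal matrix `G_n` with diagonal entries `k r + k (k - 1) σ² / 2` and
subdiagonal entries `k / T` in row `k`, for `k = 0, …, n`. -/
def momentMatrix (n : ℕ) (r σ T : ℝ) : Matrix (Fin (n + 1)) (Fin (n + 1)) ℝ :=
  Matrix.of fun k j ↦
    if (j : ℕ) = k then ((k : ℕ) : ℝ) * r + 1 / 2 * ((k : ℕ) : ℝ) * (((k : ℕ) : ℝ) - 1) * σ ^ 2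
    else if (j : ℕ) + 1 = k then ((k : ℕ) : ℝ) / T
    else 0

end

/-! The proof has two halves: `S` is identified with the geometric Brownian motion `E t = exp ((r -
σ² / 2) t + σ B t)`, and the moments of `Y t = ∫₀ᵗ E` are computed.

Stochastic integrals are only limits in probability of left-endpoint sums, so everything is done on
uniform grids. An exact algebraic expansion (`geometricBM_expansion`) writes the sums for `E` as the
expected limit plus errors; the remainder tends to `0` in `L²` by the discrete Itô isometry. Hence
`D = S - E` is, along a subsequence of grids, the a.s. limit of its own sums `r D dt + σ D dB`.
Killing `D` when it leaves `[-M, M]` makes it square integrable; the isometry and Fatou's lemma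
bound its second moment by a constant times Riemann sums of that second moment, and iterating gives
`M² (C t)ᵐ / m! → 0`. Continuity of paths then lets `M` grow.

For the moments put `m k j t = 𝔼[E tʲ Y tᵏ]` and let `c j` be the `j`-th diagonal entry of `G_n`.
From `Yᵏ⁺¹ = (k + 1) ∫ Yᵏ E du`, Tonelli and independence of increments, `m` satisfies the recursion
defining `mixedMoment`, so `m k j' = c j * m k j + k * m (k - 1) (j + 1)`. This system raises `j`
while the matrix system `x' = G_n x` lowers it. They are dual: `∑ⱼ (k choose j) Tʲ m (k - j) j t * x
j (T - t)` does not depend on `t`, and comparing `t = T` with `t = 0` gives `𝔼[Y Tᵏ] = Tᵏ x k T`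
(`mixedMoment_duality`). -/

noncomputable section

/-! ### Uniform partitions and Riemann sums -/

/-- The `k`-th point of the uniform partition of `[0, t]` into `n + 1` intervals. -/
def uniformGrid (t : ℝ≥0) (n k : ℕ) : ℝ≥0 := t * k / (n + 1)

lemma coe_uniformGrid (t : ℝ≥0) (n k : ℕ) : (uniformGrid t n k : ℝ) = t * k / (n + 1) := by
  simp [uniformGrid]

@[simp] lemma uniformGrid_zero (t : ℝ≥0) (n : ℕ) : uniformGrid t n 0 = 0 := by simp [uniformGrid]

@[simp] lemma uniformGrid_last (t : ℝ≥0) (n : ℕ) : uniformGrid t n (n + 1) = t := by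
  rw [← NNReal.coe_inj, coe_uniformGrid]; push_cast; field_simp

lemma uniformGrid_monotone (t : ℝ≥0) (n : ℕ) : Monotone (uniformGrid t n) := by
  intro a b hab
  unfold uniformGrid
  gcongr

lemma uniformGrid_step (t : ℝ≥0) (n k : ℕ) :
    (uniformGrid t n (k + 1) : ℝ) - uniformGrid t n k = t / (n + 1) := by
  rw [coe_uniformGrid, coe_uniformGrid]; push_cast; ring

lemma tendsto_const_div_nat_succ (a : ℝ) :
    Tendsto (fun n : ℕ ↦ a / ((n : ℝ) + 1)) atTop (𝓝 0) := by
  simpa [div_eq_mul_inv] using (tendsto_one_div_add_atTop_nhds_zero_nat (𝕜 := ℝ)).const_mul a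

lemma isVanishingPartition_uniformGrid (t : ℝ≥0) :
    IsVanishingPartition t (fun n ↦ n + 1) (uniformGrid t) where
  mono := uniformGrid_monotone t
  left := uniformGrid_zero t
  right := uniformGrid_last t
  mesh ε hε := by
    filter_upwards [(tendsto_const_div_nat_succ t).eventually_le_const hε] with n hn k _
    rwa [uniformGrid_step]

/-- The left-endpoint Riemann sum of `f` over the uniform partition of `[0, t]`. -/
def riemannSum (f : ℝ≥0 → ℝ) (t : ℝ≥0) (n : ℕ) : ℝ :=
  ∑ k ∈ Finset.range (n + 1), f (uniformGrid t n k) * (t / (n + 1))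

lemma tendsto_riemannSum {f : ℝ≥0 → ℝ} (hf : Continuous f) (t : ℝ≥0) :
    Tendsto (riemannSum f t) atTop (𝓝 (∫ u in (0 : ℝ)..(t : ℝ), f u.toNNReal)) := by
  have hc : Continuous fun u : ℝ ↦ f u.toNNReal := hf.comp continuous_real_toNNReal
  rw [Metric.tendsto_nhds]
  intro ε hε
  have huc := (isCompact_Icc (a := (0 : ℝ)) (b := t)).uniformContinuousOn_of_continuous
    hc.continuousOn
  -- The denominator `t + 1` allows `t = 0` and makes the final bound `ε * (t / (t + 1))` strictly
  -- less than `ε`.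
  have hε' : 0 < ε / (t + 1) := by positivity
  obtain ⟨δ, hδ, huc⟩ := Metric.uniformContinuousOn_iff.1 huc _ hε'
  filter_upwards [(tendsto_const_div_nat_succ t).eventually_lt_const hδ] with n hn
  have hsum : ∫ u in (0 : ℝ)..(t : ℝ), f u.toNNReal = ∑ k ∈ Finset.range (n + 1),
      ∫ u in (uniformGrid t n k : ℝ)..(uniformGrid t n (k + 1) : ℝ), f u.toNNReal := by
    rw [intervalIntegral.sum_integral_adjacent_intervals (a := fun k ↦ (uniformGrid t n k : ℝ))
      fun k _ ↦ hc.intervalIntegrable _ _]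
    simp
  have hpiece : ∀ k ∈ Finset.range (n + 1),
      dist (f (uniformGrid t n k) * (t / (n + 1)))
        (∫ u in (uniformGrid t n k : ℝ)..(uniformGrid t n (k + 1) : ℝ), f u.toNNReal)
      ≤ ε / (t + 1) * (t / (n + 1)) := by
    intro k hk
    have hle : (uniformGrid t n k : ℝ) ≤ uniformGrid t n (k + 1) :=
      NNReal.coe_le_coe.2 (uniformGrid_monotone t n k.le_succ)
    have hlast : (uniformGrid t n (k + 1) : ℝ) ≤ t := by
      conv_rhs => rw [← uniformGrid_last t n]
      exact NNReal.coe_le_coe.2 (uniformGrid_monotone t n (Finset.mem_range.1 hk))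
    have hst := uniformGrid_step t n k
    have hconst : f (uniformGrid t n k) * (t / (n + 1)) =
        ∫ _ in (uniformGrid t n k : ℝ)..(uniformGrid t n (k + 1) : ℝ), f (uniformGrid t n k) := by
      rw [intervalIntegral.integral_const, hst, smul_eq_mul, mul_comm]
    rw [hconst, dist_eq_norm, ← intervalIntegral.integral_sub (by simp)
      (hc.intervalIntegrable _ _)]
    refine (intervalIntegral.norm_integral_le_of_norm_le_const (C := ε / (t + 1))
      fun u hu ↦ ?_).trans_eq ?_
    · rw [Set.uIoc_of_le hle] at hu
      have h0 : (0 : ℝ) ≤ uniformGrid t n k := NNReal.coe_nonneg _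
      have := huc (uniformGrid t n k) ⟨h0, hle.trans hlast⟩ u
        ⟨h0.trans hu.1.le, hu.2.trans hlast⟩ (by
          rw [Real.dist_eq, abs_lt]; constructor <;> linarith [hu.1, hu.2])
      rw [Real.toNNReal_coe, dist_eq_norm] at this
      exact this.le
    · rw [hst, abs_of_nonneg (by positivity)]
  rw [hsum, riemannSum]
  calc _ ≤ ∑ k ∈ Finset.range (n + 1), ε / (t + 1) * ((t : ℝ) / (n + 1)) :=
        (dist_sum_sum_le _ _ _).trans (Finset.sum_le_sum hpiece)
    _ = ε * (t / (t + 1)) := by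
        rw [Finset.sum_const, Finset.card_range, nsmul_eq_mul]; push_cast; field_simp
    _ < ε * 1 := by
        gcongr
        rw [div_lt_one (by positivity)]; linarith
    _ = ε := mul_one ε

/-! ### Gaussian integrals -/

lemma integral_exp_gaussianReal_zero (v : ℝ≥0) (a : ℝ) :
    ∫ x, Real.exp (a * x) ∂gaussianReal 0 v = Real.exp (v * a ^ 2 / 2) := by
  have := mgf_gaussianReal (p := gaussianReal 0 v) (X := id) (μ := 0) (v := v) (by simp) a
  simpa [mgf] using this

lemma integral_mul_exp_gaussianReal_zero (v : ℝ≥0) (a : ℝ) :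
    ∫ x, x * Real.exp (a * x) ∂gaussianReal 0 v = v * a * Real.exp (v * a ^ 2 / 2) := by
  have h1 := hasDerivAt_mgf (X := fun x : ℝ ↦ x) (μ := gaussianReal 0 v) (t := a) (by simp)
  rw [mgf_fun_id_gaussianReal] at h1
  have h2 : HasDerivAt (fun t : ℝ ↦ Real.exp (0 * t + v * t ^ 2 / 2))
      (v * a * Real.exp (v * a ^ 2 / 2)) a := by
    have h3 : HasDerivAt (fun t : ℝ ↦ 0 * t + v * t ^ 2 / 2) (v * a) a := by
      have := (((hasDerivAt_pow 2 a).const_mul (v : ℝ)).div_const 2)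
      simp only [zero_mul, zero_add]
      refine this.congr_deriv ?_
      push_cast; ring
    convert h3.exp using 1
    simp [mul_comm]
  exact h1.unique h2

lemma integral_sq_gaussianReal_zero (v : ℝ≥0) : ∫ x, x ^ 2 ∂gaussianReal 0 v = v := by
  have := variance_eq_integral (μ := gaussianReal 0 v) (X := fun x : ℝ ↦ x) (by fun_prop)
  simpa using this.symm

lemma integrable_mul_exp_gaussianReal_zero (v : ℝ≥0) (a : ℝ) :
    Integrable (fun x : ℝ ↦ x * Real.exp (a * x)) (gaussianReal 0 v) := by
  simpa using integrable_pow_mul_exp_of_mem_interior_integrableExpSet (X := fun x : ℝ ↦ x)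
    (μ := gaussianReal 0 v) (v := a) (by simp) 1

/-- The second-order remainder of the exponential martingale of Gaussian increments. -/
def expRemainder (a v x : ℝ) : ℝ := Real.exp (a * x - a ^ 2 * v / 2) - 1 - a * x

lemma continuous_expRemainder (a v : ℝ) : Continuous (expRemainder a v) := by
  unfold expRemainder; fun_prop

lemma memLp_exp_gaussianReal_zero (v : ℝ≥0) (a : ℝ) :
    MemLp (fun x : ℝ ↦ Real.exp (a * x)) 2 (gaussianReal 0 v) := by
  rw [memLp_two_iff_integrable_sq (by fun_prop)]
  refine (integrable_exp_mul_gaussianReal (μ := 0) (v := v) (2 * a)).congr (ae_of_all _ fun x ↦ ?_)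
  simp only
  rw [← Real.exp_nat_mul]; congr 1; push_cast; ring

lemma memLp_expRemainder (a : ℝ) (v : ℝ≥0) :
    MemLp (expRemainder a v) 2 (gaussianReal 0 v) := by
  have h : expRemainder a v = fun x ↦ Real.exp (-(a ^ 2 * v / 2)) * Real.exp (a * x) - 1 - a * x := by
    ext x
    rw [expRemainder, ← Real.exp_add]; ring_nf
  rw [h]
  exact (((memLp_exp_gaussianReal_zero v a).const_mul _).sub (memLp_const 1)).sub
    ((memLp_id_gaussianReal 2).const_mul a)

lemma integral_expRemainder (a : ℝ) (v : ℝ≥0) :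
    ∫ x, expRemainder a v x ∂gaussianReal 0 v = 0 := by
  have h : expRemainder a v = fun x ↦ Real.exp (-(a ^ 2 * v / 2)) * Real.exp (a * x) - 1 - a * x := by
    ext x
    rw [expRemainder, ← Real.exp_add]; ring_nf
  have i1 := (integrable_exp_mul_gaussianReal (μ := 0) (v := v) a).const_mul
    (Real.exp (-(a ^ 2 * v / 2)))
  have i2 : Integrable (fun x : ℝ ↦ a * x) (gaussianReal 0 v) :=
    ((memLp_id_gaussianReal 1).integrable le_rfl).const_mul a
  have i3 : Integrable (fun x : ℝ ↦ Real.exp (-(a ^ 2 * v / 2)) * Real.exp (a * x) - 1)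
    (gaussianReal 0 v) := i1.sub (integrable_const 1)
  rw [h, integral_sub i3 i2, integral_sub i1 (integrable_const 1),
    integral_const_mul, integral_const_mul, integral_exp_gaussianReal_zero, ← Real.exp_add]
  simp
  ring_nf; simp

/-- Expand the square, using the Gaussian integrals of `exp (a x)`, `x exp (a x)` and `x ^ 2`. The
value is of order `v²`, so the sum over a grid of mesh `v` is of order `v`. -/
lemma integral_expRemainder_sq (a : ℝ) (v : ℝ≥0) :
    ∫ x, expRemainder a v x ^ 2 ∂gaussianReal 0 v = Real.exp (a ^ 2 * v) - 1 - a ^ 2 * v := by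
  set c := Real.exp (-(a ^ 2 * v / 2)) with hc
  have h : (fun x ↦ expRemainder a v x ^ 2) = fun x ↦ c ^ 2 * Real.exp ((2 * a) * x)
      - (2 * c) * Real.exp (a * x) - (2 * a * c) * (x * Real.exp (a * x)) + 1 + (2 * a) * x
      + a ^ 2 * x ^ 2 := by
    ext x
    have e1 : Real.exp (a * x - a ^ 2 * v / 2) = c * Real.exp (a * x) := by
      rw [hc, ← Real.exp_add]; ring_nf
    have e2 : Real.exp ((2 * a) * x) = Real.exp (a * x) ^ 2 := by
      rw [← Real.exp_nat_mul]; congr 1; push_cast; ring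
    rw [expRemainder, e1, e2]; ring
  have ix : Integrable (fun x : ℝ ↦ x) (gaussianReal 0 v) :=
    (memLp_id_gaussianReal 1).integrable le_rfl
  have ix2 : Integrable (fun x : ℝ ↦ x ^ 2) (gaussianReal 0 v) :=
    (memLp_id_gaussianReal 2).integrable_sq
  have i1 := (integrable_exp_mul_gaussianReal (μ := 0) (v := v) (2 * a)).const_mul (c ^ 2)
  have i2 := (integrable_exp_mul_gaussianReal (μ := 0) (v := v) a).const_mul (2 * c)
  have i3 := (integrable_mul_exp_gaussianReal_zero v a).const_mul (2 * a * c)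
  have i5 := ix.const_mul (2 * a)
  have i6 := ix2.const_mul (a ^ 2)
  have j2 : Integrable (fun x ↦ c ^ 2 * Real.exp ((2 * a) * x) - (2 * c) * Real.exp (a * x))
    (gaussianReal 0 v) := i1.sub i2
  have j3 : Integrable (fun x ↦ c ^ 2 * Real.exp ((2 * a) * x) - (2 * c) * Real.exp (a * x)
    - (2 * a * c) * (x * Real.exp (a * x))) (gaussianReal 0 v) := j2.sub i3
  have j4 := j3.fun_add (integrable_const (1 : ℝ))
  have j5 := j4.fun_add i5
  rw [h, integral_add j5 i6, integral_add j4 i5, integral_add j3 (integrable_const 1),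
    integral_sub j2 i3, integral_sub i1 i2]
  have e0 : ∫ x, 2 * a * x ∂gaussianReal 0 v = 0 := by
    rw [integral_const_mul, integral_id_gaussianReal, mul_zero]
  rw [e0]
  simp only [integral_const_mul, integral_exp_gaussianReal_zero, integral_mul_exp_gaussianReal_zero,
    integral_sq_gaussianReal_zero]
  have e1 : c * Real.exp (v * a ^ 2 / 2) = 1 := by
    rw [hc, ← Real.exp_add, ← Real.exp_zero]; ring_nf
  have e2 : c ^ 2 * Real.exp (v * (2 * a) ^ 2 / 2) = Real.exp (a ^ 2 * v) := by
    rw [hc, ← Real.exp_nat_mul, ← Real.exp_add]; congr 1; push_cast; ring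
  rw [e2]
  simp
  linear_combination (-2 - 2 * a ^ 2 * v) * e1

/-! ### Discrete Itô isometry -/

section Transform

variable {Ω : Type*} {mΩ : MeasurableSpace Ω} {Q : Measure Ω}
  {𝓕 : Filtration ℝ≥0 mΩ}

/-- Discrete Itô isometry. -/
lemma martingaleTransform_isometry [IsProbabilityMeasure Q] {τ : ℕ → ℝ≥0} (hτ : Monotone τ) {X ζ : ℕ → Ω → ℝ} {v : ℕ → ℝ}
    (hX : ∀ k, Measurable[𝓕 (τ k)] (X k)) (hX2 : ∀ k, MemLp (X k) 2 Q)
    (hζ : ∀ k, Measurable[𝓕 (τ (k + 1))] (ζ k)) (hζ2 : ∀ k, MemLp (ζ k) 2 Q)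
    (hind : ∀ k (Z : Ω → ℝ), Measurable[𝓕 (τ k)] Z → IndepFun Z (ζ k) Q)
    (h0 : ∀ k, ∫ ω, ζ k ω ∂Q = 0) (hv : ∀ k, ∫ ω, ζ k ω ^ 2 ∂Q = v k) (n : ℕ) :
    Measurable[𝓕 (τ n)] (fun ω ↦ ∑ k ∈ Finset.range n, X k ω * ζ k ω) ∧
    MemLp (fun ω ↦ ∑ k ∈ Finset.range n, X k ω * ζ k ω) 2 Q ∧
    ∫ ω, (∑ k ∈ Finset.range n, X k ω * ζ k ω) ^ 2 ∂Q =
      ∑ k ∈ Finset.range n, (∫ ω, X k ω ^ 2 ∂Q) * v k := by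
  induction n with
  | zero => simp
  | succ n ih =>
    obtain ⟨ih1, ih2, ih3⟩ := ih
    simp only [Finset.sum_range_succ]
    set W : Ω → ℝ := fun ω ↦ ∑ k ∈ Finset.range n, X k ω * ζ k ω with hW
    have hmono := 𝓕.mono (hτ n.le_succ)
    have hsq : IndepFun (fun ω ↦ X n ω ^ 2) (fun ω ↦ ζ n ω ^ 2) Q :=
      (hind n _ (hX n)).comp (measurable_id.pow_const 2) (measurable_id.pow_const 2)
    have hsqint : Integrable (fun ω ↦ (X n ω * ζ n ω) ^ 2) Q := by
      simp only [mul_pow]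
      exact hsq.integrable_mul (hX2 n).integrable_sq (hζ2 n).integrable_sq
    have hp2 : MemLp (fun ω ↦ X n ω * ζ n ω) 2 Q :=
      (memLp_two_iff_integrable_sq ((hX2 n).1.mul (hζ2 n).1)).2 hsqint
    have hWX : Integrable (fun ω ↦ W ω * X n ω) Q := ih2.integrable_mul (hX2 n)
    have hWXm : Measurable[𝓕 (τ n)] (fun ω ↦ W ω * X n ω) := ih1.mul (hX n)
    -- Orthogonality of increments: `W * X n` belongs to the past, and `ζ n` is independent of it
    -- with mean zero.
    have hcross : ∫ ω, W ω * X n ω * ζ n ω ∂Q = 0 := by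
      rw [(hind n _ hWXm).integral_fun_mul_eq_mul_integral hWX.1 (hζ2 n).1, h0, mul_zero]
    have hcrossint : Integrable (fun ω ↦ W ω * X n ω * ζ n ω) Q :=
      (hind n _ hWXm).integrable_mul hWX ((hζ2 n).integrable one_le_two)
    refine ⟨(ih1.mono hmono le_rfl).add (((hX n).mono hmono le_rfl).mul (hζ n)), ih2.add hp2, ?_⟩
    have : ∀ ω, (W ω + X n ω * ζ n ω) ^ 2 =
        W ω ^ 2 + 2 * (W ω * X n ω * ζ n ω) + (X n ω * ζ n ω) ^ 2 := fun ω ↦ by ring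
    change ∫ ω, (W ω + X n ω * ζ n ω) ^ 2 ∂Q = _
    have hWi := ih2.integrable_sq
    have hWci := hWi.fun_add (hcrossint.const_mul 2)
    simp only [this]
    rw [integral_add hWci hsqint,
      integral_add hWi (hcrossint.const_mul 2), integral_const_mul, hcross, ih3]
    simp only [mul_pow]
    rw [hsq.integral_fun_mul_eq_mul_integral (hX2 n).integrable_sq.1 (hζ2 n).integrable_sq.1, hv]
    ring

variable {B : ℝ≥0 → Ω → ℝ}

namespace IsStdBrownianMotion

lemma measurable (hB : IsStdBrownianMotion 𝓕 B Q) (t : ℝ≥0) : Measurable (B t) :=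
  (hB.adapted t).mono (𝓕.le t) le_rfl

lemma indepFun (hB : IsStdBrownianMotion 𝓕 B Q) {s t : ℝ≥0} (hst : s ≤ t) {β : Type*}
    [MeasurableSpace β] {Z : Ω → β} (hZ : Measurable[𝓕 s] Z) :
    IndepFun Z (fun ω ↦ B t ω - B s ω) Q := by
  rw [IndepFun_iff_Indep]
  have h := hB.indep_increments s t hst
  rw [← BorelSpace.measurable_eq (α := ℝ)] at h
  exact indep_of_indep_of_le_left h.symm hZ.comap_le

lemma hasLaw_increment (hB : IsStdBrownianMotion 𝓕 B Q) {s t : ℝ≥0} (hst : s ≤ t) :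
    HasLaw (fun ω ↦ B t ω - B s ω) (gaussianReal 0 (t - s)) Q := by
  have h := hB.isBrownian.toIsPreBrownianReal.hasLaw_sub t s
  have e : nndist (t : ℝ) (s : ℝ) = t - s := by
    rw [← NNReal.coe_inj, coe_nndist, Real.dist_eq, NNReal.coe_sub hst, abs_of_nonneg]
    exact sub_nonneg.2 (NNReal.coe_le_coe.2 hst)
  change HasLaw (fun ω ↦ B t ω - B s ω) (gaussianReal 0 (nndist (t : ℝ) (s : ℝ))) Q at h
  rwa [e] at h

/-- Discrete Itô isometry for a transform of Brownian increments over a uniform partition. -/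
lemma transform_isometry [IsProbabilityMeasure Q] (hB : IsStdBrownianMotion 𝓕 B Q) (t : ℝ≥0) (n : ℕ) {X : ℕ → Ω → ℝ}
    (hX : ∀ k, Measurable[𝓕 (uniformGrid t n k)] (X k)) (hX2 : ∀ k, MemLp (X k) 2 Q)
    {g : ℝ → ℝ} (hg : Measurable g)
    (hg2 : MemLp g 2 (gaussianReal 0 (t / (n + 1)))) (hg0 : ∫ x, g x ∂gaussianReal 0 (t / (n + 1)) = 0)
    (m : ℕ) :
    MemLp (fun ω ↦ ∑ k ∈ Finset.range m,
      X k ω * g (B (uniformGrid t n (k + 1)) ω - B (uniformGrid t n k) ω)) 2 Q ∧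
    ∫ ω, (∑ k ∈ Finset.range m,
      X k ω * g (B (uniformGrid t n (k + 1)) ω - B (uniformGrid t n k) ω)) ^ 2 ∂Q =
      ∑ k ∈ Finset.range m,
        (∫ ω, X k ω ^ 2 ∂Q) * ∫ x, g x ^ 2 ∂gaussianReal 0 (t / (n + 1)) := by
  have hmono k : uniformGrid t n k ≤ uniformGrid t n (k + 1) := uniformGrid_monotone t n k.le_succ
  have hlaw k : HasLaw (fun ω ↦ B (uniformGrid t n (k + 1)) ω - B (uniformGrid t n k) ω)
      (gaussianReal 0 (t / (n + 1))) Q := by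
    have e : uniformGrid t n (k + 1) - uniformGrid t n k = t / (n + 1) := by
      rw [← NNReal.coe_inj, NNReal.coe_sub (hmono k), uniformGrid_step]; simp
    exact e ▸ hB.hasLaw_increment (hmono k)
  refine (martingaleTransform_isometry (uniformGrid_monotone t n) hX hX2 (fun k ↦ ?_) (fun k ↦ ?_)
    (fun k Z hZ ↦ ?_) (fun k ↦ ?_) (fun k ↦ ?_) m).2
  · exact hg.comp ((hB.adapted _).sub ((hB.adapted _).mono (𝓕.mono (hmono k)) le_rfl))
  · have := hg2
    rw [← (hlaw k).map_eq] at this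
    exact this.comp_of_map (hlaw k).aemeasurable
  · exact (hB.indepFun (hmono k) hZ).comp measurable_id hg
  · exact ((hlaw k).integral_comp hg.aestronglyMeasurable).trans hg0
  · exact (hlaw k).integral_comp (f := fun x ↦ g x ^ 2) (hg.pow_const 2).aestronglyMeasurable

end IsStdBrownianMotion

end Transform

/-! ### Geometric Brownian motion solves the equation -/

section GeometricBrownianMotion

variable {Ω : Type*} {mΩ : MeasurableSpace Ω} {Q : Measure Ω} {𝓕 : Filtration ℝ≥0 mΩ}
  {B : ℝ≥0 → Ω → ℝ}

/-- Geometric Brownian motion `exp ((r - σ² / 2) t + σ B t)`. -/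
def geometricBM (B : ℝ≥0 → Ω → ℝ) (r σ : ℝ) (t : ℝ≥0) (ω : Ω) : ℝ :=
  Real.exp ((r - σ ^ 2 / 2) * t + σ * B t ω)

namespace IsStdBrownianMotion

lemma geometricBM_adapted (hB : IsStdBrownianMotion 𝓕 B Q) (r σ : ℝ) (t : ℝ≥0) :
    Measurable[𝓕 t] (geometricBM B r σ t) :=
  Real.measurable_exp.comp (((hB.adapted t).const_mul σ).const_add _)

lemma memLp_geometricBM (hB : IsStdBrownianMotion 𝓕 B Q) (r σ : ℝ) (t : ℝ≥0) :
    MemLp (geometricBM B r σ t) 2 Q := by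
  have hlaw := hB.isBrownian.toIsPreBrownianReal.hasLaw_eval t
  have h := memLp_exp_gaussianReal_zero t σ
  rw [← hlaw.map_eq] at h
  have h' : geometricBM B r σ t =
      fun ω ↦ Real.exp ((r - σ ^ 2 / 2) * t) * ((fun x ↦ Real.exp (σ * x)) ∘ B t) ω := by
    ext ω; simp [geometricBM, Real.exp_add]
  rw [h']
  exact (h.comp_of_map hlaw.aemeasurable).const_mul _

lemma integral_geometricBM_sq (hB : IsStdBrownianMotion 𝓕 B Q) (r σ : ℝ) (t : ℝ≥0) :
    ∫ ω, geometricBM B r σ t ω ^ 2 ∂Q = Real.exp ((2 * r + σ ^ 2) * t) := by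
  have hlaw := hB.isBrownian.toIsPreBrownianReal.hasLaw_eval t
  have h' : (fun ω ↦ geometricBM B r σ t ω ^ 2) =
      fun ω ↦ Real.exp ((2 * r - σ ^ 2) * t) * ((fun x ↦ Real.exp ((2 * σ) * x)) ∘ B t) ω := by
    ext ω
    simp only [geometricBM, Function.comp]
    rw [← Real.exp_add, ← Real.exp_nat_mul]
    congr 1; push_cast; ring
  rw [h', integral_const_mul, hlaw.integral_comp (by fun_prop), integral_exp_gaussianReal_zero,
    ← Real.exp_add]
  congr 1; ring

end IsStdBrownianMotion

/-- The remainder of the first-order Itô expansion of geometric Brownian motion. -/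
def itoRemainder (B : ℝ≥0 → Ω → ℝ) (r σ : ℝ) (t : ℝ≥0) (n : ℕ) (ω : Ω) : ℝ :=
  ∑ k ∈ Finset.range (n + 1), geometricBM B r σ (uniformGrid t n k) ω *
    expRemainder σ (t / (n + 1)) (B (uniformGrid t n (k + 1)) ω - B (uniformGrid t n k) ω)

/-- `dslope` is the quotient `(1 - exp (-r d)) / d` with its limit `r` filled in at `d = 0`, so `t =
0` needs no separate case. -/
lemma tendsto_dslope_exp (r : ℝ) (t : ℝ) :
    Tendsto (fun n : ℕ ↦ dslope (fun x ↦ 1 - Real.exp (-(r * x))) 0 (t / (n + 1)))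
      atTop (𝓝 r) := by
  have hd : HasDerivAt (fun x : ℝ ↦ 1 - Real.exp (-(r * x))) r 0 := by
    have := (((hasDerivAt_id (0 : ℝ)).const_mul r).fun_neg.exp).const_sub 1
    simpa using this
  have hc := continuousAt_dslope_same.2 hd.differentiableAt
  have := hc.tendsto.comp (tendsto_const_div_nat_succ t)
  rwa [dslope_same, hd.deriv] at this

lemma geometricBM_expansion (B : ℝ≥0 → Ω → ℝ) (r σ : ℝ) (t : ℝ≥0) (n : ℕ) (ω : Ω) :
    σ * ∑ k ∈ Finset.range (n + 1), geometricBM B r σ (uniformGrid t n k) ω *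
      (B (uniformGrid t n (k + 1)) ω - B (uniformGrid t n k) ω) =
    geometricBM B r σ t ω - geometricBM B r σ 0 ω
      - dslope (fun x ↦ 1 - Real.exp (-(r * x))) 0 (t / (n + 1)) *
        (riemannSum (fun s ↦ geometricBM B r σ s ω) t n +
          t / (n + 1) * (geometricBM B r σ t ω - geometricBM B r σ 0 ω))
      - itoRemainder B r σ t n ω := by
  set E : ℕ → ℝ := fun k ↦ geometricBM B r σ (uniformGrid t n k) ω with hE
  set d : ℝ := t / (n + 1) with hd
  set a := dslope (fun x ↦ 1 - Real.exp (-(r * x))) 0 d with ha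
  have had : a * d = 1 - Real.exp (-(r * d)) := by
    have := sub_smul_dslope (fun x ↦ 1 - Real.exp (-(r * x))) 0 d
    simp only [sub_zero, smul_eq_mul, mul_zero, neg_zero, Real.exp_zero, sub_self] at this
    rw [ha, mul_comm]; exact this
  -- With `exp (-r d) = 1 - a d`, this rearranges `h1`. Writing `E (k + 1)` as `E k` plus an
  -- increment produces a left-endpoint Riemann sum and a telescoping correction.
  have hstep k : σ * (E k * (B (uniformGrid t n (k + 1)) ω - B (uniformGrid t n k) ω)) =
      (E (k + 1) - E k) - a * d * (E k + (E (k + 1) - E k)) -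
      E k * expRemainder σ d (B (uniformGrid t n (k + 1)) ω - B (uniformGrid t n k) ω) := by
    have h1 : Real.exp (-(r * d)) * E (k + 1) = E k * Real.exp
        (σ * (B (uniformGrid t n (k + 1)) ω - B (uniformGrid t n k) ω) - σ ^ 2 * d / 2) := by
      simp only [hE, geometricBM]
      rw [← Real.exp_add, ← Real.exp_add]
      congr 1
      have := uniformGrid_step t n k
      rw [← hd] at this
      linear_combination (r - σ ^ 2 / 2) * this
    rw [had, expRemainder]
    linear_combination -h1
  have hlast : geometricBM B r σ t ω = E (n + 1) := by simp [hE]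
  have hzero : geometricBM B r σ 0 ω = E 0 := by simp [hE]
  have hrs : riemannSum (fun s ↦ geometricBM B r σ s ω) t n =
      ∑ k ∈ Finset.range (n + 1), E k * d := rfl
  have hir : itoRemainder B r σ t n ω = ∑ k ∈ Finset.range (n + 1),
      E k * expRemainder σ d (B (uniformGrid t n (k + 1)) ω - B (uniformGrid t n k) ω) := rfl
  rw [hlast, hzero, hrs, hir, Finset.mul_sum, Finset.sum_congr rfl fun k _ ↦ hstep k,
    Finset.sum_sub_distrib, Finset.sum_sub_distrib, ← Finset.mul_sum, Finset.sum_add_distrib,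
    Finset.sum_range_sub, ← Finset.sum_mul]
  ring

namespace IsStdBrownianMotion

variable [IsProbabilityMeasure Q]

lemma itoRemainder_sq (hB : IsStdBrownianMotion 𝓕 B Q) (r σ : ℝ) (t : ℝ≥0) (n : ℕ) :
    MemLp (itoRemainder B r σ t n) 2 Q ∧
    ∫ ω, itoRemainder B r σ t n ω ^ 2 ∂Q =
      ∑ k ∈ Finset.range (n + 1), Real.exp ((2 * r + σ ^ 2) * uniformGrid t n k) *
        (Real.exp (σ ^ 2 * (t / (n + 1))) - 1 - σ ^ 2 * (t / (n + 1))) := by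
  have hc : (((t / (n + 1) : ℝ≥0)) : ℝ) = t / (n + 1) := by push_cast; rfl
  have h0 := integral_expRemainder σ (t / (n + 1))
  have h2 := memLp_expRemainder σ (t / (n + 1))
  have hs := integral_expRemainder_sq σ (t / (n + 1))
  rw [hc] at h0 h2 hs
  have := hB.transform_isometry t n (fun k ↦ hB.geometricBM_adapted r σ _)
    (fun k ↦ hB.memLp_geometricBM r σ _) (continuous_expRemainder σ (t / (n + 1))).measurable
    h2 h0 (n + 1)
  simp only [hB.integral_geometricBM_sq, hs] at this
  exact this

/-- There are `n + 1` terms, each of order `(t / (n + 1))²` since `exp x - 1 - x ≤ x²` for `|x| ≤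
1`. -/
lemma tendsto_integral_itoRemainder_sq (hB : IsStdBrownianMotion 𝓕 B Q) (r σ : ℝ) (t : ℝ≥0) :
    Tendsto (fun n ↦ ∫ ω, itoRemainder B r σ t n ω ^ 2 ∂Q) atTop (𝓝 0) := by
  set K := Real.exp (|2 * r + σ ^ 2| * t) with hK
  refine squeeze_zero' (.of_forall fun n ↦ integral_nonneg fun ω ↦ sq_nonneg _) ?_
    (tendsto_const_div_nat_succ (K * (σ ^ 2 * t) ^ 2))
  filter_upwards [(tendsto_const_div_nat_succ (σ ^ 2 * t)).eventually_le_const one_pos] with n hn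
  rw [(hB.itoRemainder_sq r σ t n).2]
  have hx0 : 0 ≤ σ ^ 2 * (t / ((n : ℝ) + 1)) := by positivity
  have hx1 : |σ ^ 2 * (t / ((n : ℝ) + 1))| ≤ 1 := by
    rw [abs_of_nonneg hx0, ← mul_div_assoc]; exact hn
  have hexp := (abs_le.1 (Real.abs_exp_sub_one_sub_id_le hx1)).2
  calc _ ≤ ∑ k ∈ Finset.range (n + 1), K * (σ ^ 2 * (t / ((n : ℝ) + 1))) ^ 2 := by
        refine Finset.sum_le_sum fun k hk ↦ mul_le_mul (Real.exp_le_exp.2 ?_) hexp ?_ (by positivity)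
        · refine (mul_le_mul_of_nonneg_right (le_abs_self _) (NNReal.coe_nonneg _)).trans ?_
          refine mul_le_mul_of_nonneg_left (NNReal.coe_le_coe.2 ?_) (abs_nonneg _)
          conv_rhs => rw [← uniformGrid_last t n]
          exact uniformGrid_monotone t n (Finset.mem_range.1 hk).le
        · have := Real.add_one_le_exp (σ ^ 2 * (t / ((n : ℝ) + 1)))
          linarith
    _ = _ := by
        rw [Finset.sum_const, Finset.card_range, nsmul_eq_mul]; push_cast; field_simp

/-- Itô's formula for geometric Brownian motion, along a subsequence of uniform partitions. -/
lemma exists_subseq_tendsto_sum_geometricBM (hB : IsStdBrownianMotion 𝓕 B Q) (r σ : ℝ) (t : ℝ≥0)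
    {ns : ℕ → ℕ} (hns : StrictMono ns) :
    ∃ ms : ℕ → ℕ, StrictMono ms ∧ ∀ᵐ ω ∂Q, Tendsto (fun i ↦
      σ * ∑ k ∈ Finset.range (ns (ms i) + 1),
        geometricBM B r σ (uniformGrid t (ns (ms i)) k) ω *
        (B (uniformGrid t (ns (ms i)) (k + 1)) ω - B (uniformGrid t (ns (ms i)) k) ω)) atTop
      (𝓝 (geometricBM B r σ t ω - 1 -
        r * ∫ u in (0 : ℝ)..(t : ℝ), geometricBM B r σ u.toNNReal ω)) := by
  have hmeas : TendstoInMeasure Q (fun i ↦ itoRemainder B r σ t (ns i)) atTop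
      (fun _ ↦ (0 : ℝ)) := by
    refine tendstoInMeasure_of_tendsto_eLpNorm (p := 2) two_ne_zero
      (fun i ↦ (hB.itoRemainder_sq r σ t (ns i)).1.1) aestronglyMeasurable_const ?_
    have h1 : ∀ i, eLpNorm (itoRemainder B r σ t (ns i) - fun _ ↦ (0 : ℝ)) 2 Q =
        ENNReal.ofReal ((∫ ω, itoRemainder B r σ t (ns i) ω ^ 2 ∂Q) ^ ((2 : ℝ)⁻¹)) := by
      intro i
      have e : (itoRemainder B r σ t (ns i) - fun _ ↦ (0 : ℝ)) = itoRemainder B r σ t (ns i) := by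
        ext ω; simp
      rw [e, (hB.itoRemainder_sq r σ t (ns i)).1.eLpNorm_eq_integral_rpow_norm two_ne_zero
        ENNReal.ofNat_ne_top]
      simp
    simp only [h1]
    have h2 := ((hB.tendsto_integral_itoRemainder_sq r σ t).comp hns.tendsto_atTop).rpow_const
      (p := (2 : ℝ)⁻¹) (Or.inr (by norm_num))
    rw [Real.zero_rpow (by norm_num)] at h2
    simpa using ENNReal.tendsto_ofReal h2
  obtain ⟨ms, hms, hae⟩ := hmeas.exists_seq_tendsto_ae
  refine ⟨ms, hms, ?_⟩
  filter_upwards [hae, hB.isBrownian.cont, hB.isBrownian.eval_zero_ae_eq_zero] with ω h1 h2 h3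
  have hcont : Continuous fun s ↦ geometricBM B r σ s ω := by
    unfold geometricBM; fun_prop
  have hsub : Tendsto (fun i ↦ ns (ms i)) atTop atTop :=
    hns.tendsto_atTop.comp hms.tendsto_atTop
  have hzero : geometricBM B r σ 0 ω = 1 := by simp [geometricBM, h3]
  simp only [geometricBM_expansion, hzero]
  have l1 := (tendsto_dslope_exp r t).comp hsub
  have l2 := (tendsto_riemannSum hcont t).comp hsub
  have l3 := ((tendsto_const_div_nat_succ t).comp hsub).mul_const
    (geometricBM B r σ t ω - geometricBM B r σ 0 ω)
  have := ((tendsto_const_nhds (x := geometricBM B r σ t ω - geometricBM B r σ 0 ω)).sub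
    (l1.mul (l2.add l3))).sub h1
  rw [zero_mul, add_zero, sub_zero, hzero] at this
  exact this

end IsStdBrownianMotion

end GeometricBrownianMotion

/-! ### Elementary bounds for the uniqueness argument -/

lemma pow_mul_sub_le {a b : ℝ} (ha : 0 ≤ a) (hab : a ≤ b) (m : ℕ) :
    a ^ m * (b - a) ≤ (b ^ (m + 1) - a ^ (m + 1)) / (m + 1) := by
  rw [le_div_iff₀ (by positivity)]
  induction m with
  | zero => simp
  | succ m ih =>
    have h1 : 0 ≤ b ^ (m + 1) - a ^ (m + 1) := sub_nonneg.2 (pow_le_pow_left₀ ha hab _)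
    have h2 := mul_le_mul_of_nonneg_left ih ha
    have h3 := mul_le_mul_of_nonneg_right hab h1
    push_cast
    calc _ = a * (a ^ m * (b - a) * (m + 1)) + a ^ (m + 1) * (b - a) := by ring
      _ ≤ b * (b ^ (m + 1) - a ^ (m + 1)) + a ^ (m + 1) * (b - a) := by linarith
      _ = _ := by ring

/-- Left-endpoint sums of an increasing function lie below its integral. As this holds for every
`n`, the Gronwall iteration can run on sums, without integrating second moments in time. -/
lemma riemannSum_pow_le (t : ℝ≥0) (n m : ℕ) :
    riemannSum (fun s ↦ (s : ℝ) ^ m) t n ≤ (t : ℝ) ^ (m + 1) / (m + 1) := by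
  have h : ∀ k ∈ Finset.range (n + 1), (uniformGrid t n k : ℝ) ^ m * (t / (n + 1)) ≤
      (uniformGrid t n (k + 1) : ℝ) ^ (m + 1) / (m + 1) -
        (uniformGrid t n k : ℝ) ^ (m + 1) / (m + 1) := by
    intro k _
    rw [← uniformGrid_step t n k, ← sub_div]
    exact pow_mul_sub_le (NNReal.coe_nonneg _)
      (NNReal.coe_le_coe.2 (uniformGrid_monotone t n k.le_succ)) m
  refine (Finset.sum_le_sum h).trans_eq ?_
  rw [Finset.sum_range_sub (fun k ↦ (uniformGrid t n k : ℝ) ^ (m + 1) / (m + 1))]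
  simp

lemma abs_le_of_forall_denseSeq {f : ℝ≥0 → ℝ} (hf : Continuous f) {M : ℝ} {t : ℝ≥0}
    (h0 : |f 0| ≤ M)
    (h : ∀ i, TopologicalSpace.denseSeq ℝ≥0 i ≤ t → |f (TopologicalSpace.denseSeq ℝ≥0 i)| ≤ M)
    {s : ℝ≥0} (hs : s ≤ t) : |f s| ≤ M := by
  -- Time `0` is not a limit of earlier times, which is why it has its own hypothesis.
  rcases eq_or_ne s 0 with rfl | hs0
  · exact h0
  have hclosed : IsClosed {u | |f u| ≤ M} := isClosed_le hf.abs continuous_const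
  have hsub : Set.Iio s ∩ Set.range (TopologicalSpace.denseSeq ℝ≥0) ⊆ {u | |f u| ≤ M} := by
    rintro _ ⟨hu, i, rfl⟩
    exact h i (le_of_lt (lt_of_lt_of_le hu hs))
  have h1 := (TopologicalSpace.denseRange_denseSeq ℝ≥0).open_subset_closure_inter
    (isOpen_Iio (a := s))
  have h2 : s ∈ closure (Set.Iio s) := by
    rw [closure_Iio' ⟨0, pos_iff_ne_zero.2 hs0⟩]; exact Set.mem_Iic.2 le_rfl
  have h3 := closure_minimal h1 isClosed_closure h2
  exact hclosed.closure_subset_iff.2 hsub h3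

/-! ### Uniqueness for the linear equation -/

section Uniqueness

variable {Ω : Type*} {mΩ : MeasurableSpace Ω} {Q : Measure Ω} {𝓕 : Filtration ℝ≥0 mΩ}
  {B D : ℝ≥0 → Ω → ℝ}

/-- The left-endpoint sums of `r D dt + σ D dB` over the uniform partitions of `[0, t]`. -/
def linearSum (B D : ℝ≥0 → Ω → ℝ) (r σ : ℝ) (t : ℝ≥0) (n : ℕ) (ω : Ω) : ℝ :=
  r * riemannSum (fun s ↦ D s ω) t n + σ * ∑ k ∈ Finset.range (n + 1),
    D (uniformGrid t n k) ω * (B (uniformGrid t n (k + 1)) ω - B (uniformGrid t n k) ω)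

/-- The event that `|D|` does not exceed `M` at time `0` and at the points of a countable dense
set before time `t`. -/
def boundedUntil (D : ℝ≥0 → Ω → ℝ) (M : ℝ) (t : ℝ≥0) : Set Ω :=
  {ω | |D 0 ω| ≤ M} ∩ ⋂ i ∈ {i | TopologicalSpace.denseSeq ℝ≥0 i ≤ t},
    {ω | |D (TopologicalSpace.denseSeq ℝ≥0 i) ω| ≤ M}

/-- The process `D`, killed when it leaves `[-M, M]`. -/
def killed (D : ℝ≥0 → Ω → ℝ) (M : ℝ) (t : ℝ≥0) : Ω → ℝ :=
  (boundedUntil D M t).indicator fun ω ↦ max (-M) (min M (D t ω))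

lemma measurableSet_boundedUntil (hD : ∀ t, Measurable[𝓕 t] (D t)) (M : ℝ) (t : ℝ≥0) :
    MeasurableSet[𝓕 t] (boundedUntil D M t) := by
  have h : ∀ s ≤ t, MeasurableSet[𝓕 t] {ω | |D s ω| ≤ M} := fun s hs ↦
    𝓕.mono hs _ (hD s (measurableSet_le (f := fun x : ℝ ↦ |x|) measurable_id.abs measurable_const))
  refine (h 0 zero_le).inter ?_
  exact MeasurableSet.biInter (Set.to_countable _) fun i hi ↦ h _ hi

lemma killed_adapted (hD : ∀ t, Measurable[𝓕 t] (D t)) (M : ℝ) (t : ℝ≥0) :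
    Measurable[𝓕 t] (killed D M t) :=
  (measurable_const.max (measurable_const.min (hD t))).indicator (measurableSet_boundedUntil hD M t)

/-- The truncation in `killed` gives this on every path; the event alone controls `D t` only on
continuous ones. -/
lemma abs_killed_le {M : ℝ} (hM : 0 ≤ M) (t : ℝ≥0) (ω : Ω) : |killed D M t ω| ≤ M := by
  unfold killed
  by_cases h : ω ∈ boundedUntil D M t
  · rw [Set.indicator_of_mem h, abs_le]
    exact ⟨le_max_left _ _, max_le (by linarith) (min_le_left _ _)⟩
  · rw [Set.indicator_of_notMem h, abs_zero]; exact hM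

/-- The events `boundedUntil` decrease in time, so a path not yet killed at `t` agrees with `D` on
all of `[0, t]`. -/
lemma killed_eq_of_mem {M : ℝ} {s t : ℝ≥0} {ω : Ω} (hc : Continuous fun u ↦ D u ω) (hst : s ≤ t)
    (hω : ω ∈ boundedUntil D M t) : killed D M s ω = D s ω := by
  have hω' : ω ∈ boundedUntil D M s := by
    refine ⟨hω.1, ?_⟩
    have := hω.2
    simp only [Set.mem_iInter] at this ⊢
    exact fun i hi ↦ this i (le_trans hi hst)
  rw [killed, Set.indicator_of_mem hω']
  have hb : |D s ω| ≤ M := by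
    have := hω.2
    simp only [Set.mem_iInter] at this
    exact abs_le_of_forall_denseSeq hc hω.1 this hst
  rw [min_eq_right (abs_le.1 hb).2, max_eq_right (abs_le.1 hb).1]

lemma exists_nat_mem_boundedUntil {ω : Ω} (hc : Continuous fun u ↦ D u ω) (t : ℝ≥0) :
    ∃ M : ℕ, ω ∈ boundedUntil D M t := by
  obtain ⟨C, hC⟩ := (isCompact_Icc (a := (0 : ℝ≥0)) (b := t)).exists_bound_of_continuousOn
    hc.continuousOn
  obtain ⟨M, hM⟩ := exists_nat_ge C
  have h : ∀ s ≤ t, |D s ω| ≤ M := fun s hs ↦ (hC s ⟨zero_le, hs⟩).trans hM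
  refine ⟨M, h 0 zero_le, ?_⟩
  simp only [Set.mem_iInter]
  exact fun i hi ↦ h _ hi

variable [IsProbabilityMeasure Q]

lemma memLp_killed (hD : ∀ t, Measurable[𝓕 t] (D t)) {M : ℝ} (hM : 0 ≤ M) (t : ℝ≥0) :
    MemLp (killed D M t) 2 Q :=
  MemLp.of_bound ((killed_adapted hD M t).mono (𝓕.le t) le_rfl).aestronglyMeasurable M
    (ae_of_all _ fun ω ↦ abs_killed_le hM t ω)

lemma measurable_linearSum (hB : ∀ t, Measurable (B t)) (hD : ∀ t, Measurable (D t)) (r σ : ℝ)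
    (t : ℝ≥0) (n : ℕ) : Measurable (linearSum B D r σ t n) := by
  unfold linearSum riemannSum
  fun_prop

/-- `(x + y)² ≤ 2 (x² + y²)`, then Cauchy-Schwarz for the `dt` sum, which costs the factor `t`, and
the discrete isometry for the `dB` sum. -/
lemma IsStdBrownianMotion.linearSum_sq_le (hB : IsStdBrownianMotion 𝓕 B Q)
    (hD : ∀ t, Measurable[𝓕 t] (D t)) (hD2 : ∀ t, MemLp (D t) 2 Q) (r σ : ℝ) (t : ℝ≥0) (n : ℕ) :
    Integrable (fun ω ↦ linearSum B D r σ t n ω ^ 2) Q ∧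
    ∫ ω, linearSum B D r σ t n ω ^ 2 ∂Q ≤
      (2 * r ^ 2 * t + 2 * σ ^ 2) * riemannSum (fun s ↦ ∫ ω, D s ω ^ 2 ∂Q) t n := by
  obtain ⟨h1, h2⟩ := hB.transform_isometry t n (fun k ↦ hD _) (fun k ↦ hD2 _) measurable_id
    (memLp_id_gaussianReal 2) integral_id_gaussianReal (n + 1)
  simp only [id, integral_sq_gaussianReal_zero] at h1 h2
  set d : ℝ := t / (n + 1) with hd
  have hcoe : (((t / (n + 1) : ℝ≥0)) : ℝ) = d := by push_cast; rfl
  rw [hcoe] at h2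
  have hR : MemLp (fun ω ↦ riemannSum (fun s ↦ D s ω) t n) 2 Q :=
    memLp_finsetSum _ fun k _ ↦ (hD2 _).mul_const _
  have hV : MemLp (linearSum B D r σ t n) 2 Q := (hR.const_mul r).add (h1.const_mul σ)
  refine ⟨hV.integrable_sq, ?_⟩
  have hsq : ∀ ω, riemannSum (fun s ↦ D s ω) t n ^ 2 ≤
      t * riemannSum (fun s ↦ D s ω ^ 2) t n := by
    intro ω
    have := sq_sum_le_card_mul_sum_sq (s := Finset.range (n + 1))
      (f := fun k ↦ D (uniformGrid t n k) ω * d)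
    refine this.trans_eq ?_
    simp only [riemannSum, Finset.card_range, mul_pow]
    rw [← Finset.sum_mul, ← Finset.sum_mul, ← hd]
    have : ((n + 1 : ℕ) : ℝ) * d = t := by rw [hd]; push_cast; field_simp
    linear_combination (∑ k ∈ Finset.range (n + 1), D (uniformGrid t n k) ω ^ 2) * d * this
  have hRint : Integrable (fun ω ↦ riemannSum (fun s ↦ D s ω ^ 2) t n) Q :=
    integrable_finsetSum _ fun k _ ↦ (hD2 _).integrable_sq.mul_const _
  have hRI : ∫ ω, riemannSum (fun s ↦ D s ω ^ 2) t n ∂Q =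
      riemannSum (fun s ↦ ∫ ω, D s ω ^ 2 ∂Q) t n := by
    unfold riemannSum
    rw [integral_finsetSum _ fun k _ ↦ (hD2 _).integrable_sq.mul_const _]
    simp only [integral_mul_const]
  have i1 := hRint.const_mul (2 * r ^ 2 * t)
  have i2 := h1.integrable_sq.const_mul (2 * σ ^ 2)
  refine (integral_mono hV.integrable_sq (i1.add i2) fun ω ↦ ?_).trans_eq ?_
  · have h3 := mul_le_mul_of_nonneg_left (hsq ω) (by positivity : 0 ≤ 2 * r ^ 2)
    simp only [linearSum, Pi.add_apply]
    refine (add_sq_le).trans ?_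
    rw [mul_pow, mul_pow]
    linarith
  · simp only [Pi.add_apply]
    rw [integral_add i1 i2, integral_const_mul, integral_const_mul, h2, hRI]
    simp only [riemannSum]
    rw [← hd]
    ring

/-- One step of the Gronwall iteration. -/
lemma integral_killed_sq_le (hB : IsStdBrownianMotion 𝓕 B Q) (hD : ∀ t, Measurable[𝓕 t] (D t))
    (hc : ∀ᵐ ω ∂Q, Continuous fun t ↦ D t ω) {r σ : ℝ} {t : ℝ≥0}
    (h : ∃ ns : ℕ → ℕ, ∀ᵐ ω ∂Q,
      Tendsto (fun i ↦ linearSum B D r σ t (ns i) ω) atTop (𝓝 (D t ω)))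
    {M : ℝ} (hM : 0 ≤ M) {c : ℝ}
    (hle : ∀ n, (2 * r ^ 2 * t + 2 * σ ^ 2) *
      riemannSum (fun s ↦ ∫ ω, killed D M s ω ^ 2 ∂Q) t n ≤ c) :
    ∫ ω, killed D M t ω ^ 2 ∂Q ≤ c := by
  obtain ⟨ns, hns⟩ := h
  have hV n := hB.linearSum_sq_le (killed_adapted hD M) (memLp_killed hD hM) r σ t n
  have hc0 : 0 ≤ c := (integral_nonneg fun ω ↦ sq_nonneg _).trans ((hV 0).2.trans (hle 0))
  have hK m : Measurable (killed D M m) := (killed_adapted hD M m).mono (𝓕.le m) le_rfl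
  -- Fatou's lemma. Before killing, the sums for `killed D M` equal those for `D` and converge to `D
  -- t`; after killing the left side is `0`.
  have key : ∫⁻ ω, ENNReal.ofReal (killed D M t ω ^ 2) ∂Q ≤ ENNReal.ofReal c := by
    calc ∫⁻ ω, ENNReal.ofReal (killed D M t ω ^ 2) ∂Q
        ≤ ∫⁻ ω, liminf (fun i ↦
            ENNReal.ofReal (linearSum B (killed D M) r σ t (ns i) ω ^ 2)) atTop ∂Q := by
          refine lintegral_mono_ae ?_
          filter_upwards [hns, hc] with ω h1 h2
          by_cases hω : ω ∈ boundedUntil D M t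
          · have hgrid : ∀ n, linearSum B (killed D M) r σ t n ω = linearSum B D r σ t n ω := by
              intro n
              have hk : ∀ k ∈ Finset.range (n + 1),
                  killed D M (uniformGrid t n k) ω = D (uniformGrid t n k) ω := by
                intro k hk
                refine killed_eq_of_mem h2 ?_ hω
                conv_rhs => rw [← uniformGrid_last t n]
                exact uniformGrid_monotone t n (Finset.mem_range.1 hk).le
              simp only [linearSum, riemannSum]
              congr 2 <;> exact Finset.sum_congr rfl fun k hk' ↦ by rw [hk k hk']
            simp only [hgrid]
            rw [killed_eq_of_mem h2 le_rfl hω,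
              (ENNReal.tendsto_ofReal (h1.pow 2)).liminf_eq]
          · simp [killed, Set.indicator_of_notMem hω]
      _ ≤ liminf (fun i ↦ ∫⁻ ω,
            ENNReal.ofReal (linearSum B (killed D M) r σ t (ns i) ω ^ 2) ∂Q) atTop :=
          lintegral_liminf_le fun i ↦
            ((measurable_linearSum hB.measurable hK r σ t (ns i)).pow_const 2).ennreal_ofReal
      _ ≤ ENNReal.ofReal c := by
          refine liminf_le_of_frequently_le' (.of_forall fun i ↦ ?_)
          rw [← ofReal_integral_eq_lintegral_ofReal (hV _).1 (ae_of_all _ fun ω ↦ sq_nonneg _)]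
          exact ENNReal.ofReal_le_ofReal ((hV _).2.trans (hle _))
  rw [← ofReal_integral_eq_lintegral_ofReal (memLp_killed hD hM t).integrable_sq
    (ae_of_all _ fun ω ↦ sq_nonneg _)] at key
  exact (ENNReal.ofReal_le_ofReal_iff hc0).1 key

/-- A continuous adapted solution of the homogeneous linear equation vanishes. -/
theorem ae_eq_zero_of_tendsto_linearSum (hB : IsStdBrownianMotion 𝓕 B Q)
    (hD : ∀ t, Measurable[𝓕 t] (D t)) (hc : ∀ᵐ ω ∂Q, Continuous fun t ↦ D t ω) {r σ : ℝ}
    (h : ∀ t, ∃ ns : ℕ → ℕ, ∀ᵐ ω ∂Q,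
      Tendsto (fun i ↦ linearSum B D r σ t (ns i) ω) atTop (𝓝 (D t ω))) (T : ℝ≥0) :
    ∀ᵐ ω ∂Q, D T ω = 0 := by
  set C : ℝ := 2 * r ^ 2 * T + 2 * σ ^ 2 with hC
  have hC0 : 0 ≤ C := by positivity
  -- Each Gronwall step turns `sᵐ` into `tᵐ⁺¹ / (m + 1)`, which builds up the factorial.
  have hiter (M : ℝ) (hM : 0 ≤ M) (m : ℕ) : ∀ t ≤ T,
      ∫ ω, killed D M t ω ^ 2 ∂Q ≤ M ^ 2 * (C * t) ^ m / m.factorial := by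
    induction m with
    | zero =>
      intro t _
      calc _ ≤ ∫ _, M ^ 2 ∂Q := integral_mono (memLp_killed hD hM t).integrable_sq
            (integrable_const _) fun ω ↦ sq_le_sq' (abs_le.1 (abs_killed_le hM t ω)).1
              (abs_le.1 (abs_killed_le hM t ω)).2
        _ = _ := by simp
    | succ m ih =>
      intro t ht
      refine integral_killed_sq_le hB hD hc (h t) hM fun n ↦ ?_
      have h1 : riemannSum (fun s ↦ ∫ ω, killed D M s ω ^ 2 ∂Q) t n ≤
          M ^ 2 * C ^ m / m.factorial * riemannSum (fun s ↦ (s : ℝ) ^ m) t n := by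
        unfold riemannSum
        rw [Finset.mul_sum]
        refine Finset.sum_le_sum fun k hk ↦ ?_
        rw [← mul_assoc]
        refine mul_le_mul_of_nonneg_right ?_ (by positivity)
        have hkt : uniformGrid t n k ≤ t := by
          conv_rhs => rw [← uniformGrid_last t n]
          exact uniformGrid_monotone t n (Finset.mem_range.1 hk).le
        refine (ih _ (hkt.trans ht)).trans_eq ?_
        rw [mul_pow]; ring
      have h2 : 2 * r ^ 2 * t + 2 * σ ^ 2 ≤ C := by
        rw [hC]
        have : (t : ℝ) ≤ T := ht
        gcongr
      have h3 : 0 ≤ riemannSum (fun s ↦ ∫ ω, killed D M s ω ^ 2 ∂Q) t n :=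
        Finset.sum_nonneg fun k _ ↦
          mul_nonneg (integral_nonneg fun ω ↦ sq_nonneg _) (by positivity)
      calc _ ≤ C * (M ^ 2 * C ^ m / m.factorial * ((t : ℝ) ^ (m + 1) / (m + 1))) :=
            mul_le_mul h2 (h1.trans (mul_le_mul_of_nonneg_left (riemannSum_pow_le t n m)
              (by positivity))) h3 hC0
        _ = _ := by
            rw [Nat.factorial_succ]; push_cast; field_simp; rw [mul_pow]; ring
  have hzero (M : ℕ) : ∀ᵐ ω ∂Q, killed D M T ω = 0 := by
    have hM : (0 : ℝ) ≤ M := Nat.cast_nonneg M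
    have hlim : Tendsto (fun m : ℕ ↦ (M : ℝ) ^ 2 * (C * T) ^ m / m.factorial) atTop (𝓝 0) := by
      simpa [mul_div_assoc] using
        (FloorSemiring.tendsto_pow_div_factorial_atTop (C * T)).const_mul ((M : ℝ) ^ 2)
    have hle : ∫ ω, killed D M T ω ^ 2 ∂Q ≤ 0 :=
      ge_of_tendsto' hlim fun m ↦ hiter M hM m T le_rfl
    have := (integral_eq_zero_iff_of_nonneg (fun ω ↦ sq_nonneg (killed D M T ω))
      (memLp_killed hD hM T).integrable_sq).1 (le_antisymm hle (integral_nonneg fun ω ↦ sq_nonneg _))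
    filter_upwards [this] with ω hω
    simpa using hω
  filter_upwards [ae_all_iff.2 hzero, hc] with ω h1 h2
  obtain ⟨M, hM⟩ := exists_nat_mem_boundedUntil h2 T
  rw [← killed_eq_of_mem h2 le_rfl hM, h1]

/-- The Black-Scholes price is a geometric Brownian motion. -/
theorem IsBlackScholesPrice.ae_eq_geometricBM {S : ℝ≥0 → Ω → ℝ} {r σ : ℝ}
    (hS : IsBlackScholesPrice 𝓕 B r σ S Q) (hB : IsStdBrownianMotion 𝓕 B Q) :
    ∀ᵐ ω ∂Q, ∀ t, S t ω = geometricBM B r σ t ω := by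
  obtain ⟨I, hI, hSI⟩ := hS
  have hEc : ∀ᵐ ω ∂Q, Continuous fun t ↦ geometricBM B r σ t ω := by
    filter_upwards [hB.isBrownian.cont] with ω hω
    unfold geometricBM; fun_prop
  have hD (t : ℝ≥0) : ∀ᵐ ω ∂Q, S t ω - geometricBM B r σ t ω = 0 := by
    refine ae_eq_zero_of_tendsto_linearSum (D := fun t ω ↦ S t ω - geometricBM B r σ t ω)
      (r := r) (σ := σ) hB (fun t ↦ (hI.adapted t).sub (hB.geometricBM_adapted r σ t)) ?_
      (fun t ↦ ?_) t
    · filter_upwards [hI.continuous, hEc] with ω h1 h2 using h1.sub h2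
    -- Two successive extractions, so that the sums for `S` and for geometric Brownian motion
    -- converge a.s. along the same grids.
    · obtain ⟨ns, hns, h1⟩ :=
        (hI.tendsto t _ _ (isVanishingPartition_uniformGrid t)).exists_seq_tendsto_ae
      obtain ⟨ms, hms, h2⟩ := hB.exists_subseq_tendsto_sum_geometricBM r σ t hns
      refine ⟨fun i ↦ ns (ms i), ?_⟩
      filter_upwards [h1, h2, hI.continuous, hEc, hSI t] with ω h1 h2 h3 h4 h5
      have hsub : Tendsto (fun i ↦ ns (ms i)) atTop atTop :=
        hns.tendsto_atTop.comp hms.tendsto_atTop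
      have l1 := (((tendsto_riemannSum h3 t).comp hsub).const_mul r).add
        ((h1.comp hms.tendsto_atTop).const_mul σ)
      have l2 := (((tendsto_riemannSum h4 t).comp hsub).const_mul r).add h2
      have l3 := l1.sub l2
      convert l3 using 2
      · simp only [linearSum, riemannSum, Function.comp, sub_mul, Finset.sum_sub_distrib]
        ring
      · rw [h5]; ring
  -- Equality a.s. at each fixed time becomes equality of paths, by continuity and a countable dense
  -- set of times.
  have hdense := ae_all_iff.2 fun i ↦ hD (TopologicalSpace.denseSeq ℝ≥0 i)
  filter_upwards [hdense, hI.continuous, hEc] with ω h1 h2 h3 t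
  refine congrFun (Continuous.ext_on (TopologicalSpace.denseRange_denseSeq ℝ≥0) h2 h3 ?_) t
  rintro _ ⟨i, rfl⟩
  exact sub_eq_zero.1 (h1 i)

end Uniqueness

/-! ### Moment equations and their duality with the matrix exponential -/

section Moments

/-- The solution of `μ₀ⱼ = exp (c j t)`, `μₖ₊₁,ⱼ' = c j * μₖ₊₁,ⱼ + (k + 1) * μₖ,ⱼ₊₁`,
`μₖ₊₁,ⱼ(0) = 0`. -/
def mixedMoment (c : ℕ → ℝ) : ℕ → ℕ → ℝ → ℝ
  | 0, j, t => Real.exp (c j * t)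
  | k + 1, j, t => (k + 1) * (Real.exp (c j * t) *
      ∫ u in (0 : ℝ)..t, Real.exp (-(c j * u)) * mixedMoment c k (j + 1) u)

lemma continuous_mixedMoment (c : ℕ → ℝ) (k j : ℕ) : Continuous (mixedMoment c k j) := by
  induction k generalizing j with
  | zero => simp only [mixedMoment]; fun_prop
  | succ k ih =>
    have := ih (j + 1)
    have hp : Continuous fun t : ℝ ↦
        ∫ u in (0 : ℝ)..t, Real.exp (-(c j * u)) * mixedMoment c k (j + 1) u :=
      intervalIntegral.continuous_primitive
        (fun a b ↦ Continuous.intervalIntegrable (by fun_prop) a b) 0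
    have e : mixedMoment c (k + 1) j = fun t ↦ ((k : ℝ) + 1) * (Real.exp (c j * t) *
      ∫ u in (0 : ℝ)..t, Real.exp (-(c j * u)) * mixedMoment c k (j + 1) u) := by
        ext t; rw [mixedMoment]
    rw [e]
    fun_prop

lemma mixedMoment_nonneg (c : ℕ → ℝ) (k j : ℕ) {t : ℝ} (ht : 0 ≤ t) : 0 ≤ mixedMoment c k j t := by
  induction k generalizing j t with
  | zero => rw [mixedMoment]; positivity
  | succ k ih =>
    rw [mixedMoment]
    have : 0 ≤ ∫ u in (0 : ℝ)..t, Real.exp (-(c j * u)) * mixedMoment c k (j + 1) u :=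
      intervalIntegral.integral_nonneg ht fun u hu ↦ mul_nonneg (Real.exp_pos _).le (ih _ hu.1)
    positivity

/-- Variation of constants. At `k = 0` the truncated index `k - 1` is harmless because its
coefficient is `0`. -/
lemma hasDerivAt_mixedMoment (c : ℕ → ℝ) (k j : ℕ) (t : ℝ) :
    HasDerivAt (mixedMoment c k j)
      (c j * mixedMoment c k j t + k * mixedMoment c (k - 1) (j + 1) t) t := by
  have he : HasDerivAt (fun t ↦ Real.exp (c j * t)) (c j * Real.exp (c j * t)) t := by
    have := ((hasDerivAt_id t).const_mul (c j)).exp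
    simpa [mul_comm] using this
  cases k with
  | zero =>
    have e : mixedMoment c 0 j = fun t ↦ Real.exp (c j * t) := by ext t; rw [mixedMoment]
    rw [e]; simpa using he
  | succ k =>
    have hcont := continuous_mixedMoment c k (j + 1)
    have hi := (Continuous.integral_hasStrictDerivAt (f := fun u ↦
      Real.exp (-(c j * u)) * mixedMoment c k (j + 1) u) (by fun_prop) 0 t).hasDerivAt
    have e : mixedMoment c (k + 1) j = fun t ↦ ((k : ℝ) + 1) * (Real.exp (c j * t) *
      ∫ u in (0 : ℝ)..t, Real.exp (-(c j * u)) * mixedMoment c k (j + 1) u) := by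
        ext t; rw [mixedMoment]
    rw [e]
    refine ((he.mul hi).const_mul ((k : ℝ) + 1)).congr_deriv ?_
    have h1 : Real.exp (c j * t) * Real.exp (-(c j * t)) = 1 := by
      rw [← Real.exp_add, add_neg_cancel, Real.exp_zero]
    simp only [Nat.add_sub_cancel]
    push_cast
    linear_combination ((k : ℝ) + 1) * mixedMoment c k (j + 1) t * h1

lemma mixedMoment_zero_right (c : ℕ → ℝ) (k j : ℕ) :
    mixedMoment c k j 0 = if k = 0 then 1 else 0 := by
  cases k <;> simp [mixedMoment]

/-- Duality between the mixed moments and the lower bidiagonal linear system. -/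
lemma mixedMoment_duality (c : ℕ → ℝ) {T : ℝ} (hT : T ≠ 0) (k : ℕ) {x : ℕ → ℝ → ℝ}
    (hx : ∀ j ≤ k, ∀ t, HasDerivAt (x j) (c j * x j t + j / T * x (j - 1) t) t)
    (hx0 : ∀ j ≤ k, x j 0 = if j = 0 then 1 else 0) :
    mixedMoment c k 0 T = T ^ k * x k T := by
  -- These weights satisfy `w (j + 1) * (j + 1) / T = w j * (k - j)`: in the derivative of `φ` the
  -- diagonal terms cancel and the rest telescopes.
  set w : ℕ → ℝ := fun j ↦ (k.choose j : ℝ) * T ^ j with hw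
  set φ : ℝ → ℝ := fun t ↦ ∑ j ∈ Finset.range (k + 1),
    w j * (mixedMoment c (k - j) j t * x j (T - t)) with hφ
  set a : ℝ → ℕ → ℝ := fun t j ↦
    w j * (j / T) * (mixedMoment c (k - j) j t * x (j - 1) (T - t)) with ha
  have hderiv (t : ℝ) : HasDerivAt φ 0 t := by
    have h : HasDerivAt φ (∑ j ∈ Finset.range (k + 1), (a t (j + 1) - a t j)) t := by
      refine HasDerivAt.fun_sum fun j hj ↦ ?_
      have hjk : j ≤ k := Nat.lt_succ_iff.1 (Finset.mem_range.1 hj)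
      have h1 : HasDerivAt (fun t ↦ x j (T - t)) _ t := (hx j hjk (T - t)).comp_const_sub T t
      refine (((hasDerivAt_mixedMoment c (k - j) j t).mul h1).const_mul (w j)).congr_deriv ?_
      have hchoose : w (j + 1) * ((j + 1 : ℕ) / T) = w j * (k - j : ℕ) := by
        have := congrArg (Nat.cast (R := ℝ)) (Nat.choose_succ_right_eq k j)
        push_cast at this
        simp only [hw]
        field_simp
        push_cast
        linear_combination T ^ (j + 1) * this
      simp only [ha]
      rw [hchoose, Nat.add_sub_cancel, Nat.sub_sub]
      ring
    rw [Finset.sum_range_sub] at h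
    convert h using 1
    -- The lower end vanishes through the factor `j = 0`, the upper one because `k.choose (k + 1) =
    -- 0`.
    simp [ha, hw]
  have hconst := is_const_of_deriv_eq_zero (f := φ) (fun t ↦ (hderiv t).differentiableAt)
    (fun t ↦ (hderiv t).deriv) T 0
  have hleft : φ T = mixedMoment c k 0 T := by
    simp only [hφ, sub_self]
    rw [Finset.sum_eq_single 0]
    · simp [hw, hx0]
    · intro j hj hj0
      rw [hx0 j (Nat.lt_succ_iff.1 (Finset.mem_range.1 hj)), if_neg hj0]; simp
    · simp
  have hright : φ 0 = T ^ k * x k T := by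
    simp only [hφ, sub_zero, mixedMoment_zero_right]
    rw [Finset.sum_eq_single k]
    · simp [hw]
    · intro j hj hjk
      have := Finset.mem_range.1 hj
      rw [if_neg (by omega)]; simp
    · simp
  rw [← hleft, hconst, hright]

/-- The diagonal entries of the moment matrix. -/
def momentRate (r σ : ℝ) (k : ℕ) : ℝ := k * r + 1 / 2 * k * (k - 1) * σ ^ 2

lemma momentMatrix_mul_apply (n : ℕ) (r σ T : ℝ) (M : Matrix (Fin (n + 1)) (Fin (n + 1)) ℝ)
    (k l : Fin (n + 1)) :
    (momentMatrix n r σ T * M) k l = momentRate r σ k * M k l +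
      (k : ℕ) / T * M ⟨(k : ℕ) - 1, by omega⟩ l := by
  rw [Matrix.mul_apply]
  have h : ∀ j, momentMatrix n r σ T k j * M j l =
      (if j = k then momentRate r σ k * M j l else 0) +
      (if j = ⟨(k : ℕ) - 1, by omega⟩ then (k : ℕ) / T * M j l else 0) := by
    intro j
    rcases Nat.eq_zero_or_pos (k : ℕ) with hk | hk
    · simp only [momentMatrix, Matrix.of_apply, momentRate, Fin.ext_iff, hk]
      by_cases hj : (j : ℕ) = 0 <;> simp [hj]
    · simp only [momentMatrix, Matrix.of_apply, momentRate, Fin.ext_iff]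
      by_cases hj : (j : ℕ) = k
      · rw [if_pos hj, if_pos hj, if_neg (by omega)]; ring
      · by_cases hj' : (j : ℕ) + 1 = k
        · rw [if_neg hj, if_pos hj', if_neg hj, if_pos (by omega)]; ring
        · rw [if_neg hj, if_neg hj', if_neg hj, if_neg (by omega)]; ring
  simp [h, Finset.sum_add_distrib]

open scoped Matrix.Norms.Operator in
lemma hasDerivAt_exp_momentMatrix_apply (n : ℕ) (r σ T : ℝ) (k : Fin (n + 1)) (t : ℝ) :
    HasDerivAt (fun t : ℝ ↦ NormedSpace.exp (t • momentMatrix n r σ T) k 0)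
      (momentRate r σ k * NormedSpace.exp (t • momentMatrix n r σ T) k 0 +
        (k : ℕ) / T * NormedSpace.exp (t • momentMatrix n r σ T) ⟨(k : ℕ) - 1, by omega⟩ 0) t := by
  have h := hasDerivAt_exp_smul_const' (𝕂 := ℝ) (momentMatrix n r σ T) t
  have := ((Matrix.entryLinearMap ℝ ℝ k (0 : Fin (n + 1))).toContinuousLinearMap.hasFDerivAt
    (x := NormedSpace.exp (t • momentMatrix n r σ T))).comp_hasDerivAt t h
  rw [← momentMatrix_mul_apply]
  exact this

/-- Since `0 ^ 0 = 1`, `H_n(0)` is the first basis vector, so only column `0` of the exponential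
matters. -/
lemma mulVec_monomialVec_zero (n : ℕ) (M : Matrix (Fin (n + 1)) (Fin (n + 1)) ℝ)
    (k : Fin (n + 1)) : (M *ᵥ monomialVec n 0) k = M k 0 := by
  have : monomialVec n 0 = Pi.single 0 1 := by
    ext j
    simp only [monomialVec, Pi.single_apply, Fin.ext_iff, Fin.val_zero, zero_pow_eq]
  rw [this, Matrix.mulVec_single_one]; rfl

lemma mixedMoment_eq_exp_momentMatrix (n : ℕ) (r σ : ℝ) {T : ℝ} (hT : T ≠ 0) (k : Fin (n + 1)) :
    mixedMoment (momentRate r σ) k 0 T =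
      T ^ (k : ℕ) * (NormedSpace.exp (T • momentMatrix n r σ T) *ᵥ monomialVec n 0) k := by
  rw [mulVec_monomialVec_zero]
  -- The extension by `0` beyond `n` is never used: duality only involves indices `j ≤ k ≤ n`.
  set x : ℕ → ℝ → ℝ := fun j t ↦
    if h : j < n + 1 then NormedSpace.exp (t • momentMatrix n r σ T) ⟨j, h⟩ 0 else 0 with hx
  have := mixedMoment_duality (momentRate r σ) hT k (x := x) (fun j hj t ↦ ?_) (fun j hj ↦ ?_)
  · rw [this]; simp only [hx, k.isLt, dif_pos]
  · have h : j < n + 1 := by omega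
    have h' : j - 1 < n + 1 := by omega
    simp only [hx, h, h', dif_pos]
    exact hasDerivAt_exp_momentMatrix_apply n r σ T ⟨j, h⟩ t
  · have h : j < n + 1 := by omega
    simp only [hx, h, dif_pos, zero_smul, NormedSpace.exp_zero, Matrix.one_apply, Fin.ext_iff,
      Fin.val_zero]

end Moments

/-! ### Moments of the time integral -/

section MomentFormula

variable {Ω : Type*} {mΩ : MeasurableSpace Ω} {Q : Measure Ω} {𝓕 : Filtration ℝ≥0 mΩ}
  {B C : ℝ≥0 → Ω → ℝ}

/-- The time integral of geometric Brownian motion. -/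
def integralGBM (B : ℝ≥0 → Ω → ℝ) (r σ : ℝ) (t : ℝ≥0) (ω : Ω) : ℝ :=
  ∫ u in (0 : ℝ)..(t : ℝ), geometricBM B r σ u.toNNReal ω

lemma continuous_geometricBM {ω : Ω} (hω : Continuous fun t ↦ B t ω) (r σ : ℝ) :
    Continuous fun t ↦ geometricBM B r σ t ω := by
  unfold geometricBM; fun_prop

lemma geometricBM_pos (B : ℝ≥0 → Ω → ℝ) (r σ : ℝ) (t : ℝ≥0) (ω : Ω) :
    0 < geometricBM B r σ t ω := Real.exp_pos _

lemma integralGBM_nonneg (B : ℝ≥0 → Ω → ℝ) (r σ : ℝ) (t : ℝ≥0) (ω : Ω) :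
    0 ≤ integralGBM B r σ t ω :=
  intervalIntegral.integral_nonneg (NNReal.coe_nonneg _) fun _ _ ↦ (geometricBM_pos B r σ _ ω).le

lemma hasDerivAt_integral_geometricBM {ω : Ω} (hω : Continuous fun t ↦ B t ω) (r σ : ℝ) (u : ℝ) :
    HasDerivAt (fun u ↦ ∫ v in (0 : ℝ)..u, geometricBM B r σ v.toNNReal ω)
      (geometricBM B r σ u.toNNReal ω) u :=
  (Continuous.integral_hasStrictDerivAt
    ((continuous_geometricBM hω r σ).comp continuous_real_toNNReal) 0 u).hasDerivAt

lemma continuous_integralGBM {ω : Ω} (hω : Continuous fun t ↦ B t ω) (r σ : ℝ) :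
    Continuous fun t ↦ integralGBM B r σ t ω :=
  (continuous_iff_continuousAt.2 fun u ↦
    (hasDerivAt_integral_geometricBM hω r σ u).continuousAt).comp NNReal.continuous_coe

lemma integralGBM_pow_succ {ω : Ω} (hω : Continuous fun t ↦ B t ω) (r σ : ℝ) (t : ℝ≥0) (k : ℕ) :
    integralGBM B r σ t ω ^ (k + 1) = ∫ u in (0 : ℝ)..(t : ℝ), ((k : ℝ) + 1) *
      (integralGBM B r σ u.toNNReal ω ^ k * geometricBM B r σ u.toNNReal ω) := by
  have hc1 := (continuous_integralGBM hω r σ).comp continuous_real_toNNReal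
  have hc2 := (continuous_geometricBM hω r σ).comp continuous_real_toNNReal
  have hint := intervalIntegral.integral_eq_sub_of_hasDeriv_right (a := 0) (b := (t : ℝ))
    (f := fun u ↦ (∫ v in (0 : ℝ)..u, geometricBM B r σ v.toNNReal ω) ^ (k + 1))
    (f' := fun u ↦ ((k : ℝ) + 1) *
      (integralGBM B r σ u.toNNReal ω ^ k * geometricBM B r σ u.toNNReal ω))
    (Continuous.continuousOn (continuous_iff_continuousAt.2 fun u ↦
      ((hasDerivAt_integral_geometricBM hω r σ u).pow (k + 1)).continuousAt))
    (fun u hu ↦ ?_) (Continuous.intervalIntegrable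
      (continuous_const.mul ((hc1.pow k).mul hc2)) _ _)
  · rw [hint]; simp [integralGBM]
  · rw [min_eq_left t.coe_nonneg] at hu
    refine HasDerivAt.hasDerivWithinAt ?_
    refine ((hasDerivAt_integral_geometricBM hω r σ u).pow (k + 1)).congr_deriv ?_
    rw [integralGBM, Real.coe_toNNReal u hu.1.le]
    push_cast
    ring

lemma measurable_geometricBM (hB : ∀ t, Measurable (B t)) (r σ : ℝ) (t : ℝ≥0) :
    Measurable (geometricBM B r σ t) := by
  unfold geometricBM; fun_prop

lemma measurable_integralGBM (hB : ∀ t, Measurable (B t)) (hc : ∀ ω, Continuous fun t ↦ B t ω)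
    (r σ : ℝ) (t : ℝ≥0) : Measurable (integralGBM B r σ t) := by
  refine measurable_of_tendsto_metrizable
    (f := fun n ω ↦ riemannSum (fun s ↦ geometricBM B r σ s ω) t n) (fun n ↦ ?_)
    (tendsto_pi_nhds.2 fun ω ↦ tendsto_riemannSum (continuous_geometricBM (hc ω) r σ) t)
  have := measurable_geometricBM hB r σ
  unfold riemannSum
  fun_prop

namespace IsStdBrownianMotion

/-- The time integral agrees a.s. with a variable that is measurable for the past. -/
lemma exists_adapted_integralGBM (hB : IsStdBrownianMotion 𝓕 B Q) (r σ : ℝ) (t : ℝ≥0) :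
    ∃ Z : Ω → ℝ, Measurable[𝓕 t] Z ∧ ∀ᵐ ω ∂Q, integralGBM B r σ t ω = Z ω := by
  -- The `limsup` of Riemann sums is measurable for the past on all of `Ω`, whereas convergence to
  -- the integral is known only on continuous paths.
  refine ⟨fun ω ↦ limsup (fun n ↦ riemannSum (fun s ↦ geometricBM B r σ s ω) t n) atTop,
    Measurable.limsup fun n ↦ ?_, ?_⟩
  · refine Finset.measurable_sum _ fun k hk ↦ Measurable.mul_const ?_ _
    have hkt : uniformGrid t n k ≤ t := by
      conv_rhs => rw [← uniformGrid_last t n]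
      exact uniformGrid_monotone t n (Finset.mem_range.1 hk).le
    exact (hB.geometricBM_adapted r σ _).mono (𝓕.mono hkt) le_rfl
  · filter_upwards [hB.isBrownian.cont] with ω hω
    exact (tendsto_riemannSum (continuous_geometricBM hω r σ) t).limsup_eq.symm

/-- The ratio of the values at `t` and `s` is the exponential of an increment independent of `𝓕 s`,
and its `j`-th moment is `exp (momentRate r σ j * (t - s))`. Lower integrals avoid any integrability
assumption. -/
lemma lintegral_geometricBM_pow_mul (hB : IsStdBrownianMotion 𝓕 B Q) (r σ : ℝ) {s t : ℝ≥0}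
    (hst : s ≤ t) (j : ℕ) {W : Ω → ℝ} (hW : Measurable[𝓕 s] W) :
    ∫⁻ ω, ENNReal.ofReal (W ω * geometricBM B r σ t ω ^ j) ∂Q =
      ENNReal.ofReal (Real.exp (momentRate r σ j * (t - s))) *
        ∫⁻ ω, ENNReal.ofReal (W ω * geometricBM B r σ s ω ^ j) ∂Q := by
  set b : ℝ := j * ((r - σ ^ 2 / 2) * (t - s)) with hb
  set g : ℝ → ENNReal := fun x ↦ ENNReal.ofReal (Real.exp (b + j * σ * x)) with hg
  have hgm : Measurable g := by fun_prop
  have hV : Measurable[𝓕 s] fun ω ↦ ENNReal.ofReal (W ω * geometricBM B r σ s ω ^ j) :=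
    (hW.mul ((hB.geometricBM_adapted r σ s).pow_const j)).ennreal_ofReal
  have hind := (hB.indepFun hst hV).comp measurable_id hgm
  have hsplit : ∀ ω, ENNReal.ofReal (W ω * geometricBM B r σ t ω ^ j) =
      ENNReal.ofReal (W ω * geometricBM B r σ s ω ^ j) * g (B t ω - B s ω) := by
    intro ω
    rw [hg, ← ENNReal.ofReal_mul' (Real.exp_pos _).le, mul_assoc]
    congr 2
    simp only [geometricBM]
    rw [← Real.exp_nat_mul, ← Real.exp_nat_mul, ← Real.exp_add, hb]
    congr 1; ring
  have hlaw := hB.hasLaw_increment hst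
  have hgi : ∫⁻ ω, g (B t ω - B s ω) ∂Q =
      ENNReal.ofReal (Real.exp (momentRate r σ j * (t - s))) := by
    have e : ∀ x, g x = ENNReal.ofReal (Real.exp b * Real.exp (j * σ * x)) := fun x ↦ by
      rw [hg, ← Real.exp_add]
    have hmap : ∫⁻ ω, g (B t ω - B s ω) ∂Q = ∫⁻ x, g x ∂gaussianReal 0 (t - s) := by
      rw [← hlaw.map_eq, lintegral_map' hgm.aemeasurable hlaw.aemeasurable]
    rw [hmap]
    simp only [e]
    rw [← ofReal_integral_eq_lintegral_ofReal
      ((integrable_exp_mul_gaussianReal (j * σ)).const_mul _)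
      (ae_of_all _ fun x ↦ by positivity), integral_const_mul, integral_exp_gaussianReal_zero,
      ← Real.exp_add, NNReal.coe_sub hst, hb, momentRate]
    congr 2; ring
  simp only [hsplit]
  have := lintegral_mul_eq_lintegral_mul_lintegral_of_indepFun (μ := Q)
    (hV.mono (𝓕.le s) le_rfl) (hgm.comp ((hB.measurable t).sub (hB.measurable s))) hind
  simp only [Pi.mul_apply, Pi.sub_apply, Function.comp] at this
  rw [this, hgi, mul_comm]

/-- Conditioning on the past for the mixed moments. -/
lemma lintegral_mixed (hB : IsStdBrownianMotion 𝓕 B Q) (r σ : ℝ) {s t : ℝ≥0}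
    (hst : s ≤ t) (j k : ℕ) :
    ∫⁻ ω, ENNReal.ofReal (geometricBM B r σ t ω ^ j *
        (integralGBM B r σ s ω ^ k * geometricBM B r σ s ω)) ∂Q =
      ENNReal.ofReal (Real.exp (momentRate r σ j * (t - s))) *
        ∫⁻ ω, ENNReal.ofReal
          (geometricBM B r σ s ω ^ (j + 1) * integralGBM B r σ s ω ^ k) ∂Q := by
  obtain ⟨Z, hZ, hZe⟩ := hB.exists_adapted_integralGBM r σ s
  have := hB.lintegral_geometricBM_pow_mul r σ hst j
    ((hZ.pow_const k).mul (hB.geometricBM_adapted r σ s))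
  convert this using 1
  · refine lintegral_congr_ae ?_
    filter_upwards [hZe] with ω hω
    simp only [Pi.mul_apply, hω]
    congr 1; ring
  · congr 1
    refine lintegral_congr_ae ?_
    filter_upwards [hZe] with ω hω
    simp only [Pi.mul_apply, hω]
    congr 1; ring

/-- A version of Brownian motion all of whose paths are continuous. -/
lemma exists_continuous_version (hB : IsStdBrownianMotion 𝓕 B Q) :
    ∃ C : ℝ≥0 → Ω → ℝ, (∀ t, Measurable (C t)) ∧ (∀ ω, Continuous fun t ↦ C t ω) ∧
      ∀ᵐ ω ∂Q, ∀ t, C t ω = B t ω := by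
  obtain ⟨N, hN, hNm, hN0⟩ := exists_measurable_superset_of_null (ae_iff.1 hB.isBrownian.cont)
  refine ⟨fun t ↦ Nᶜ.indicator (B t), fun t ↦ (hB.measurable t).indicator hNm.compl, fun ω ↦ ?_, ?_⟩
  · by_cases h : ω ∈ N
    · simp [Set.indicator, h, continuous_const]
    · have : Continuous (B · ω) := by
        by_contra h'
        exact h (hN h')
      simpa [Set.indicator, h] using this
  · filter_upwards [compl_mem_ae_iff.2 hN0] with ω hω t
    exact Set.indicator_of_mem hω _

variable [IsProbabilityMeasure Q]

/-- Induction on `k` for all `j` at once: expand the power of the time integral, swap integrals by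
Tonelli, and condition at the inner time `u`. The everywhere continuous `C` supplies the joint
measurability for the swap. -/
lemma lintegral_mixed_eq_mixedMoment (hB : IsStdBrownianMotion 𝓕 B Q) (r σ : ℝ)
    (hCm : ∀ t, Measurable (C t)) (hCc : ∀ ω, Continuous fun t ↦ C t ω)
    (hCB : ∀ᵐ ω ∂Q, ∀ t, C t ω = B t ω) (k j : ℕ) (t : ℝ≥0) :
    ∫⁻ ω, ENNReal.ofReal (geometricBM C r σ t ω ^ j * integralGBM C r σ t ω ^ k) ∂Q =
      ENNReal.ofReal (mixedMoment (momentRate r σ) k j t) := by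
  have hG : ∀ᵐ ω ∂Q, ∀ t, geometricBM C r σ t ω = geometricBM B r σ t ω := by
    filter_upwards [hCB] with ω hω t
    simp [geometricBM, hω]
  have hY : ∀ᵐ ω ∂Q, ∀ t, integralGBM C r σ t ω = integralGBM B r σ t ω := by
    filter_upwards [hG] with ω hω t
    simp [integralGBM, hω]
  -- `C` need not be adapted, as the exceptional null set may lie outside `𝓕 s`; the conditioning is
  -- done for `B` and transferred.
  have hmixed {s t : ℝ≥0} (hst : s ≤ t) (j k : ℕ) :
      ∫⁻ ω, ENNReal.ofReal (geometricBM C r σ t ω ^ j *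
        (integralGBM C r σ s ω ^ k * geometricBM C r σ s ω)) ∂Q =
      ENNReal.ofReal (Real.exp (momentRate r σ j * (t - s))) *
        ∫⁻ ω, ENNReal.ofReal
          (geometricBM C r σ s ω ^ (j + 1) * integralGBM C r σ s ω ^ k) ∂Q := by
    convert hB.lintegral_mixed r σ hst j k using 1
    · refine lintegral_congr_ae ?_
      filter_upwards [hG, hY] with ω h1 h2
      rw [h1, h1, h2]
    · congr 1
      refine lintegral_congr_ae ?_
      filter_upwards [hG, hY] with ω h1 h2
      rw [h1, h2]
  induction k generalizing j t with
  | zero =>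
    have h := hB.lintegral_geometricBM_pow_mul r σ (zero_le : 0 ≤ t) j
      (measurable_const (a := (1 : ℝ)))
    have h0 : ∫⁻ ω, ENNReal.ofReal (1 * geometricBM B r σ 0 ω ^ j) ∂Q = 1 := by
      rw [← measure_univ (μ := Q), ← lintegral_one]
      refine lintegral_congr_ae ?_
      filter_upwards [hB.isBrownian.eval_zero_ae_eq_zero] with ω hω
      simp [geometricBM, hω]
    rw [h0, mul_one] at h
    rw [mixedMoment]
    simp only [NNReal.coe_zero, sub_zero] at h
    rw [← h]
    refine lintegral_congr_ae ?_
    filter_upwards [hG] with ω hω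
    simp [hω]
  | succ k ih =>
    set c := momentRate r σ with hc
    set F : Ω → ℝ → ℝ := fun ω u ↦ ((k : ℝ) + 1) * (geometricBM C r σ t ω ^ j *
      (integralGBM C r σ u.toNNReal ω ^ k * geometricBM C r σ u.toNNReal ω)) with hF
    have hF0 ω u : 0 ≤ F ω u := by
      have := integralGBM_nonneg C r σ u.toNNReal ω
      have := geometricBM_pos C r σ u.toNNReal ω
      have := geometricBM_pos C r σ t ω
      positivity
    have hFc ω : Continuous (F ω) := by
      have hc1 := (continuous_integralGBM (hCc ω) r σ).comp continuous_real_toNNReal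
      have hc2 := (continuous_geometricBM (hCc ω) r σ).comp continuous_real_toNNReal
      exact continuous_const.mul (continuous_const.mul ((hc1.pow k).mul hc2))
    have hFm : Measurable (Function.uncurry F) := by
      have h1 : Measurable (Function.uncurry fun (u : ℝ) ω ↦ F ω u) := by
        refine measurable_uncurry_of_continuous_of_measurable (fun ω ↦ hFc ω) fun u ↦ ?_
        exact (((measurable_geometricBM hCm r σ t).pow_const j).mul
          (((measurable_integralGBM hCm hCc r σ _).pow_const k).mul
            (measurable_geometricBM hCm r σ _))).const_mul _
      exact h1.comp measurable_swap
    have hpath ω : ENNReal.ofReal (geometricBM C r σ t ω ^ j * integralGBM C r σ t ω ^ (k + 1)) =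
        ∫⁻ u in Set.Ioc 0 (t : ℝ), ENNReal.ofReal (F ω u) := by
      rw [← ofReal_integral_eq_lintegral_ofReal
        ((hFc ω).integrableOn_Icc.mono_set Set.Ioc_subset_Icc_self)
        (ae_of_all _ (hF0 ω)), ← intervalIntegral.integral_of_le t.coe_nonneg,
        integralGBM_pow_succ (hCc ω), ← intervalIntegral.integral_const_mul]
      congr 2
      ext u
      simp only [hF]; ring
    set f : ℝ → ℝ := fun u ↦ ((k : ℝ) + 1) * (Real.exp (c j * (t - u)) *
      mixedMoment c k (j + 1) u) with hf
    have hfc : Continuous f := by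
      have := continuous_mixedMoment c k (j + 1)
      fun_prop
    have hinner : ∀ u ∈ Set.Ioc 0 (t : ℝ),
        ∫⁻ ω, ENNReal.ofReal (F ω u) ∂Q = ENNReal.ofReal (f u) := by
      intro u hu
      have hut : u.toNNReal ≤ t := Real.toNNReal_le_iff_le_coe.2 hu.2
      have hk : (0 : ℝ) ≤ (k : ℝ) + 1 := by positivity
      simp only [hF, hf, ENNReal.ofReal_mul hk]
      rw [lintegral_const_mul' _ _ ENNReal.ofReal_ne_top, hmixed hut, ih,
        ENNReal.ofReal_mul (Real.exp_pos _).le, Real.coe_toNNReal u hu.1.le]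
    simp only [hpath]
    rw [lintegral_lintegral_swap hFm.ennreal_ofReal.aemeasurable,
      setLIntegral_congr_fun measurableSet_Ioc hinner,
      ← ofReal_integral_eq_lintegral_ofReal (hfc.integrableOn_Icc.mono_set Set.Ioc_subset_Icc_self)
        ((ae_restrict_iff' measurableSet_Ioc).2 (ae_of_all _ fun u hu ↦ mul_nonneg (by positivity)
          (mul_nonneg (Real.exp_pos _).le (mixedMoment_nonneg c k (j + 1) hu.1.le)))),
      ← intervalIntegral.integral_of_le t.coe_nonneg, mixedMoment]
    have hexp (u : ℝ) : Real.exp (c j * (t - u)) * mixedMoment c k (j + 1) u =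
        Real.exp (c j * t) * (Real.exp (-(c j * u)) * mixedMoment c k (j + 1) u) := by
      rw [← mul_assoc, ← Real.exp_add]
      congr 2; ring
    simp only [hf, hexp, intervalIntegral.integral_const_mul]

/-- The moments of the time integral of geometric Brownian motion. -/
lemma integral_integralGBM_pow (hB : IsStdBrownianMotion 𝓕 B Q) (r σ : ℝ) (k : ℕ) (t : ℝ≥0) :
    Integrable (fun ω ↦ integralGBM B r σ t ω ^ k) Q ∧
      ∫ ω, integralGBM B r σ t ω ^ k ∂Q = mixedMoment (momentRate r σ) k 0 t := by
  obtain ⟨C, hCm, hCc, hCB⟩ := hB.exists_continuous_version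
  have h := hB.lintegral_mixed_eq_mixedMoment r σ hCm hCc hCB k 0 t
  simp only [pow_zero, one_mul] at h
  have hCY : (fun ω ↦ integralGBM C r σ t ω ^ k) =ᵐ[Q] fun ω ↦ integralGBM B r σ t ω ^ k := by
    filter_upwards [hCB] with ω hω
    simp [integralGBM, geometricBM, hω]
  have hm : AEStronglyMeasurable (fun ω ↦ integralGBM C r σ t ω ^ k) Q :=
    ((measurable_integralGBM hCm hCc r σ t).pow_const k).aestronglyMeasurable
  have h0 : 0 ≤ᵐ[Q] fun ω ↦ integralGBM C r σ t ω ^ k :=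
    ae_of_all _ fun ω ↦ pow_nonneg (integralGBM_nonneg C r σ t ω) k
  refine ⟨Integrable.congr ⟨hm, ?_⟩ hCY, ?_⟩
  · rw [hasFiniteIntegral_iff_ofReal h0, h]
    exact ENNReal.ofReal_lt_top
  · rw [← integral_congr_ae hCY, integral_eq_lintegral_of_nonneg_ae h0 hm, h,
      ENNReal.toReal_ofReal (mixedMoment_nonneg _ _ _ t.coe_nonneg)]

end IsStdBrownianMotion

end MomentFormula

end

theorem proposition1 {Ω : Type*} {mΩ : MeasurableSpace Ω} (Q : Measure Ω) [IsProbabilityMeasure Q]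
    (𝓕 : Filtration ℝ≥0 mΩ) (B : ℝ≥0 → Ω → ℝ) (hB : IsStdBrownianMotion 𝓕 B Q)
    (r σ : ℝ) (hσ : 0 < σ) (S : ℝ≥0 → Ω → ℝ) (hS : IsBlackScholesPrice 𝓕 B r σ S Q)
    (T : ℝ≥0) (hT : 0 < T) (n : ℕ) :
    Integrable (fun ω ↦ monomialVec n (averagePrice S T ω)) Q ∧
      ∫ ω, monomialVec n (averagePrice S T ω) ∂Q =
        NormedSpace.exp ((T : ℝ) • momentMatrix n r σ T) *ᵥ monomialVec n 0 := by
  have hT' : (T : ℝ) ≠ 0 := NNReal.coe_ne_zero.2 hT.ne'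
  have hae (k : ℕ) : (fun ω ↦ (1 / (T : ℝ)) ^ k * integralGBM B r σ T ω ^ k) =ᵐ[Q]
      fun ω ↦ averagePrice S T ω ^ k := by
    filter_upwards [hS.ae_eq_geometricBM hB] with ω hω
    simp only [averagePrice, integralGBM, hω, mul_pow]
  have hint (k : Fin (n + 1)) :
      Integrable (fun ω ↦ monomialVec n (averagePrice S T ω) k) Q :=
    ((hB.integral_integralGBM_pow r σ k T).1.const_mul _).congr (hae k)
  refine ⟨Integrable.of_eval hint, ?_⟩
  ext k
  rw [eval_integral hint]
  simp only [monomialVec]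
  rw [← integral_congr_ae (hae k), integral_const_mul, (hB.integral_integralGBM_pow r σ k T).2,
    mixedMoment_eq_exp_momentMatrix n r σ hT' k, ← mul_assoc, ← mul_pow, one_div,
    inv_mul_cancel₀ hT', one_pow, one_mul]
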